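/- Let $k,d\ge 1$ be integers, let $\beta\in\,]0,2\wedge k[$, and let $F=(F^1,\dots,F^d)$ be a centered Gaussian family of $\mathbb{R}^d$-valued random vectors, indexed by $\varphi\in C_0^\infty(\mathbb{R}^{1+k})$, with covariance $$E\big(F^i(\varphi)F^j(\psi)\big)=\delta_{i,j}\int_0^\infty dr\int_{\mathbb{R}^k}\mu(d\xi)\,\mathcal{F}\varphi(r,\cdot)(\xi)\,\overline{\mathcal{F}\psi(r,\cdot)(\xi)},\qquad \mathcal{F}f(\xi)=\int_{\mathbb{R}^k}e^{-i\xi\cdot y}f(y)\,dy,$$ where the spectral measure is (hypothesis $(\mathrm{H}_\beta)$) $\mu(d\xi)=\|\xi\|^{-k+\beta}\,d\xi$. Let $\sigma=(\sigma_{i,j})$ be a deterministic invertible $d\times d$ matrix, let $G$ be the fundamental solution of the wave equation on $\mathbb{R}^k$, that is, $\mathcal{F}G(t)(\xi)=\sin(t\|\xi\|)/\|\xi\|$, and let $u=(u_1,\dots,u_d)$ be the solution on $[0,T]\times\mathbb{R}^k$ of the system $\partial_t^2u_i-\Delta u_i=\sum_j\sigma_{i,j}\dot F^j$ with vanishing initial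 conditions, i.e. $$u_i(t,x)=\int_0^t\int_{\mathbb{R}^k}G(t-r,x-y)\sum_{j=1}^d\sigma_{i,j}\,M^j(dr,dy)\quad\text{a.s.},$$ where $M^j$ is the martingale measure derived from $F^j$ and the stochastic integral of a distribution-valued deterministic integrand is the isometric extension of $\varphi\mapsto F^j(\varphi)$ to the completion of the test functions for $\|\varphi\|_0^2=\int_0^\infty dr\int\mu(d\xi)\,|\mathcal{F}\varphi(r,\cdot)(\xi)|^2$. Fix $t_0>0$ and $M,N>0$. There are constants $C,c,C_1,C_2\in\,]0,\infty[$, depending only on $k,d,\beta,\sigma,t_0,T,M,N$, such that the following hold. (a) For all $(t,x),(s,y)\in[t_0,T]\times[-M,M]^k$ with $(t,x)\ne(s,y)$, the random vector $(u(t,x),u(s,y))$ has a (continuous) density $p_{t,x;s,y}$ on $\mathbb{R}^{d}\times\mathbb{R}^d$, and for all $z_1,z_2\in[-N,N]^d$ $$p_{t,x;s,y}(z_1,z_2)\le\frac{C}{(|t-s|+\|x-y\|)^{d(2-\beta)/2}}\exp\left(-\frac{c\,\|z_1-z_2\|^2}{(|t-s|+\|x-y\|)^{2-\beta}}\right).$$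 (b) For all $(t,x)\in[t_0,T]\times\mathbb{R}^k$, the random vector $u(t,x)$ has a (continuous) density $p_{t,x}$ on $\mathbb{R}^d$, and for all $z\in[-N,N]^d$ $$C_1\le p_{t,x}(z)\le C_2 .$$ In particular $\sup_{z\in[-N,N]^d}\ \sup_{(t,x)\in[t_0,T]\times\mathbb{R}^k}p_{t,x}(z)\le C_2$. -/

import Mathlib

open MeasureTheory ProbabilityTheory Filter Topology Set TopologicalSpace
open scoped SchwartzMap Distributions FourierTransform Laplacian ENNReal

namespace StochWave

/-- The space `ℝⁿ` with its Euclidean norm. -/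
abbrev E (n : ℕ) : Type := EuclideanSpace ℝ (Fin n)

/-- Smooth compactly supported real functions on `ℝ × ℝᵏ` (time and space). -/
abbrev Test (k : ℕ) : Type := 𝓓((⊤ : Opens (ℝ × E k)), ℝ)

/-! ### The Gaussian noise -/

/-- The Fourier transform in the space variable, `ξ ↦ ∫ e^{-i ξ·y} φ(r, y) dy`. -/
noncomputable def spaceFourier {k : ℕ} (φ : Test k) (r : ℝ) (ξ : E k) : ℂ :=
  ∫ y : E k, Complex.exp (-(Complex.I * (inner ℝ ξ y : ℝ))) * (φ (r, y) : ℝ)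

/-- `F` is a centered Gaussian family of `ℝᵈ`-valued vectors indexed by test functions, with
independent components, white in time and with spatial spectral measure `μ`:
`E[Fⁱ(φ) Fʲ(ψ)] = δᵢⱼ ∫₀^∞ dr ∫ μ(dξ) 𝓕φ(r)(ξ) conj (𝓕ψ(r)(ξ))`. -/
structure IsNoise {k d : ℕ} {Ω : Type*} [MeasurableSpace Ω] (μ : Measure (E k)) (P : Measure Ω)
    (F : Test k → Ω → E d) : Prop where
  gaussian : IsGaussianProcess F P
  centered : ∀ φ i, ∫ ω, F φ ω i ∂P = 0
  covariance : ∀ φ ψ i j,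
    ((∫ ω, F φ ω i * F ψ ω j ∂P : ℝ) : ℂ) =
      if i = j then
        ∫ r in Ioi (0 : ℝ), ∫ ξ, spaceFourier φ r ξ * starRingEnd ℂ (spaceFourier ψ r ξ) ∂μ
      else 0

/-- The hypothesis `(H_β)`: `β ∈ ]0, 2 ∧ k[` and the spectral measure has density
`‖ξ‖^{-k+β}` with respect to Lebesgue measure. -/
def HypBeta {k : ℕ} (β : ℝ) (μ : Measure (E k)) : Prop :=
  0 < β ∧ β < min 2 (k : ℝ) ∧
    μ = volume.withDensity (fun ξ : E k => ENNReal.ofReal (‖ξ‖ ^ (-(k : ℝ) + β)))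

/-! ### The fundamental solution of the wave equation -/

/-- `sin (t‖ξ‖) / ‖ξ‖` (read as `t` at `ξ = 0`) at the frequency `ξ = 2π η`. -/
noncomputable def waveSymbol (k : ℕ) (t : ℝ) (η : E k) : ℂ :=
  ((t * Real.sinc (t * ‖(2 * Real.pi) • η‖) : ℝ) : ℂ)

theorem waveSymbol_eq (k : ℕ) (t : ℝ) {η : E k} (hη : η ≠ 0) :
    waveSymbol k t η =
      ((Real.sin (t * ‖(2 * Real.pi) • η‖) / ‖(2 * Real.pi) • η‖ : ℝ) : ℂ) := by
  have h : ‖(2 * Real.pi) • η‖ ≠ 0 := by simp [hη, Real.pi_ne_zero]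
  rw [waveSymbol]
  rcases eq_or_ne t 0 with rfl | ht
  · simp
  · rw [Real.sinc_of_ne_zero (mul_ne_zero ht h)]
    congr 1
    field_simp

theorem norm_waveSymbol_le (k : ℕ) (t : ℝ) (η : E k) : ‖waveSymbol k t η‖ ≤ |t| := by
  rw [waveSymbol, Complex.norm_real, norm_mul]
  exact mul_le_of_le_one_right (norm_nonneg _) (Real.abs_sinc_le_one _)

theorem continuous_waveSymbol (k : ℕ) (t : ℝ) : Continuous (waveSymbol k t) := by
  unfold waveSymbol
  fun_prop

theorem memLp_waveSymbol (k : ℕ) (t : ℝ) : MemLp (waveSymbol k t) ⊤ (volume : Measure (E k)) :=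
  memLp_top_of_bound (continuous_waveSymbol k t).aestronglyMeasurable |t|
    (Eventually.of_forall (norm_waveSymbol_le k t))

/-- The fundamental solution `G(t)` of the wave equation on `ℝᵏ`, in any dimension `k`, as a
tempered distribution: it is the inverse Fourier transform of `ξ ↦ sin (t‖ξ‖) / ‖ξ‖`. (Mathlib's
Fourier transform uses `e^{-2πi η·y}`, hence the frequency variable `η = ξ / 2π`.) -/
noncomputable def waveKernel (k : ℕ) (t : ℝ) : 𝓢'(E k, ℂ) :=
  𝓕⁻ (Lp.toTemperedDistribution ((memLp_waveSymbol k t).toLp (waveSymbol k t)))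

theorem waveKernel_apply (k : ℕ) (t : ℝ) (φ : 𝓢(E k, ℂ)) :
    waveKernel k t φ = ∫ η : E k, (𝓕⁻ φ) η * waveSymbol k t η := by
  rw [waveKernel, TemperedDistribution.fourierInv_apply, Lp.toTemperedDistribution_apply]
  apply integral_congr_ae
  filter_upwards [(memLp_waveSymbol k t).coeFn_toLp] with η h
  rw [h, smul_eq_mul]

theorem fourierInv_laplacian (k : ℕ) (φ : 𝓢(E k, ℂ)) (η : E k) :
    (𝓕⁻ (Δ φ)) η = -((‖(2 * Real.pi) • η‖ ^ 2 : ℝ) : ℂ) * (𝓕⁻ φ) η := by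
  have h1 : ∀ ψ : 𝓢(E k, ℂ), (𝓕⁻ ψ) η = (𝓕 ψ) (-η) := fun ψ => by
    rw [SchwartzMap.fourierInv_apply_eq]; rfl
  rw [h1, h1, SchwartzMap.laplacian_eq_fourierMultiplierCLM, SchwartzMap.fourierMultiplierCLM_apply]
  rw [FourierTransform.fourier_smul, FourierTransform.fourier_fourierInv_eq]
  have : (fun x : E k => ‖x‖ ^ 2).HasTemperateGrowth := by fun_prop
  have h2 : ((‖·‖ ^ 2 : E k → ℝ)) = fun x : E k => ‖x‖ ^ 2 := rfl
  simp [SchwartzMap.smulLeftCLM_apply_apply this, norm_smul, abs_of_pos Real.pi_pos, -neg_mul]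
  ring

/-- `t ↦ G(t)` is the fundamental solution: `G'' = Δ G` with `G(0) = 0` and `G'(0)` the Dirac mass
at the origin. -/
theorem waveKernel_isFundamental (k : ℕ) (φ : 𝓢(E k, ℂ)) :
    waveKernel k 0 φ = 0 ∧ ∃ v : ℝ → ℂ, v 0 = φ 0 ∧
      (∀ t, HasDerivAt (fun t => waveKernel k t φ) (v t) t) ∧
      ∀ t, HasDerivAt v ((Δ (waveKernel k t)) φ) t := by
  set ψ : 𝓢(E k, ℂ) := 𝓕⁻ φ with hψ
  have hi : Integrable ψ (volume : Measure (E k)) := ψ.integrable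
  let n : E k → ℝ := fun η => ‖(2 * Real.pi) • η‖
  have hn : Continuous n := by fun_prop
  refine ⟨by simp [waveKernel_apply, waveSymbol],
    fun t => ∫ η, ψ η * ((Real.cos (t * n η) : ℝ) : ℂ), ?_, fun t => ?_, fun t => ?_⟩
  · have : 𝓕 ψ = φ := FourierTransform.fourier_fourierInv_eq φ
    rw [← this, SchwartzMap.fourier_coe, Real.fourier_eq]
    simp
  · simp_rw [waveKernel_apply]
    refine (hasDerivAt_integral_of_dominated_loc_of_deriv_le (𝕜 := ℝ) (s := univ)
      (F := fun t η => ψ η * waveSymbol k t η)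
      (F' := fun t η => ψ η * ((Real.cos (t * n η) : ℝ) : ℂ))
      (bound := fun η => ‖ψ η‖) univ_mem ?_ ?_ ?_ ?_ hi.norm ?_).2
    · exact Eventually.of_forall fun x =>
        ψ.continuous.aestronglyMeasurable.mul (memLp_waveSymbol k x).1
    · exact hi.mul_bdd (memLp_waveSymbol k t).1
        (Eventually.of_forall (norm_waveSymbol_le k t))
    · exact Continuous.aestronglyMeasurable (by fun_prop)
    · refine Eventually.of_forall fun η x _ => ?_
      rw [norm_mul, Complex.norm_real]
      exact mul_le_of_le_one_right (norm_nonneg _) (Real.abs_cos_le_one _)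
    · refine Eventually.of_forall fun η x _ => ?_
      suffices h : HasDerivAt (fun t => t * Real.sinc (t * n η)) (Real.cos (x * n η)) x from
        h.ofReal_comp.const_mul (ψ η)
      by_cases h : n η = 0
      · simpa [h] using hasDerivAt_id' x
      · have h1 : (fun t => t * Real.sinc (t * n η)) = fun t => Real.sin (t * n η) / n η := by
          funext t
          rcases eq_or_ne t 0 with rfl | ht
          · simp
          · rw [Real.sinc_of_ne_zero (mul_ne_zero ht h)]
            field_simp
        rw [h1]
        have := ((Real.hasDerivAt_sin (x * n η)).comp x
          ((hasDerivAt_id x).mul_const (n η))).div_const (n η)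
        simpa [Function.comp_def, h] using this
  · have hb : Integrable (fun η => ‖ψ η‖ * n η) := by
      have := (SchwartzMap.integrable_pow_mul volume ψ 1).const_mul (2 * Real.pi)
      refine this.congr (Eventually.of_forall fun η => ?_)
      simp [n, norm_smul, abs_of_pos Real.pi_pos]; ring
    rw [TemperedDistribution.laplacian_apply_apply, waveKernel_apply]
    have he : ∀ η : E k, (𝓕⁻ (Δ φ)) η * waveSymbol k t η
        = ψ η * ((-Real.sin (t * n η) * n η : ℝ) : ℂ) := by
      intro η
      rw [fourierInv_laplacian]
      by_cases h : n η = 0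
      · have h' : ‖(2 * Real.pi) • η‖ = 0 := h
        rw [h, h']; simp
      · have h' : (n η : ℂ) ≠ 0 := by exact_mod_cast h
        rw [waveSymbol_eq k t (by rintro rfl; simp [n] at h)]
        change -((n η ^ 2 : ℝ) : ℂ) * ψ η * ((Real.sin (t * n η) / n η : ℝ) : ℂ) = _
        push_cast
        field_simp
    simp_rw [he]
    refine (hasDerivAt_integral_of_dominated_loc_of_deriv_le (𝕜 := ℝ) (s := univ)
      (F' := fun t η => ψ η * ((-Real.sin (t * n η) * n η : ℝ) : ℂ))
      (bound := fun η => ‖ψ η‖ * n η) univ_mem ?_ ?_ ?_ ?_ hb ?_).2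
    · exact Eventually.of_forall fun x => Continuous.aestronglyMeasurable (by fun_prop)
    · refine hi.mul_bdd (c := 1) (Continuous.aestronglyMeasurable (by fun_prop))
        (Eventually.of_forall fun η => ?_)
      rw [Complex.norm_real]
      exact Real.abs_cos_le_one _
    · exact Continuous.aestronglyMeasurable (by fun_prop)
    · refine Eventually.of_forall fun η x _ => ?_
      rw [norm_mul, Complex.norm_real, norm_mul, norm_neg]
      refine mul_le_mul_of_nonneg_left ?_ (norm_nonneg _)
      rw [Real.norm_of_nonneg (norm_nonneg _ : 0 ≤ n η)]
      exact mul_le_of_le_one_left (norm_nonneg _) (Real.abs_sin_le_one _)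
    · refine Eventually.of_forall fun η x _ => ?_
      have := ((Real.hasDerivAt_cos (x * n η)).comp x ((hasDerivAt_id x).mul_const (n η)))
      simp only [one_mul] at this
      exact (this.ofReal_comp).const_mul (ψ η)

/-- The distribution `y ↦ S(x - y)`. -/
noncomputable def reflectAt {k : ℕ} (x : E k) (S : 𝓢'(E k, ℂ)) : 𝓢'(E k, ℂ) :=
  PointwiseConvergenceCLM.precomp ℂ
    (SchwartzMap.compCLMOfAntilipschitz (g := fun y : E k => x - y) (K := 1) ℂ
      (by fun_prop) (by intro y z; simp [edist_sub_left])) S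

/-- The integrand `(r, y) ↦ G(t - r, x - y) 1_{r ≤ t}`. -/
noncomputable def waveIntegrand {k : ℕ} (t : ℝ) (x : E k) (r : ℝ) : 𝓢'(E k, ℂ) :=
  if r ≤ t then reflectAt x (waveKernel k (t - r)) else 0

/-! ### The stochastic integral and the solution -/

/-- The Fourier transform of the distribution `S` is the continuous function `g`, in the convention
`𝓕f(ξ) = ∫ e^{-i ξ·y} f(y) dy`. -/
def HasFourier {k : ℕ} (S : 𝓢'(E k, ℂ)) (g : E k → ℂ) : Prop :=
  Continuous g ∧ ∀ φ : 𝓢(E k, ℂ), (𝓕 S) φ = ∫ η : E k, φ η * g ((2 * Real.pi) • η)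

/-- `X` is the stochastic integral over `]0,∞[ × ℝᵏ`, with respect to the martingale measure of the
scalar noise `W` with spectral measure `μ`, of the deterministic distribution-valued integrand `S`:
the integral extends `φ ↦ W(φ)` by isometry to the completion of the test functions for
`‖φ‖₀² = ∫₀^∞ dr ∫ μ(dξ) |𝓕φ(r)(ξ)|²`. -/
def IsStochIntegral {k : ℕ} {Ω : Type*} [MeasurableSpace Ω] (μ : Measure (E k)) (P : Measure Ω)
    (W : Test k → Ω → ℝ) (S : ℝ → 𝓢'(E k, ℂ)) (X : Ω → ℝ) : Prop :=
  MemLp X 2 P ∧ ∃ g : ℝ → E k → ℂ, (∀ r, 0 < r → HasFourier (S r) (g r)) ∧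
    ∃ φ : ℕ → Test k,
      Tendsto (fun n => ∫⁻ r in Ioi (0 : ℝ), ∫⁻ ξ, ‖spaceFourier (φ n) r ξ - g r ξ‖ₑ ^ 2 ∂μ)
        atTop (𝓝 0) ∧
      Tendsto (fun n => eLpNorm (fun ω => W (φ n) ω - X ω) 2 P) atTop (𝓝 0)

/-- `u` is the solution on `[0,T] × ℝᵏ` of `∂²uᵢ/∂t² - Δuᵢ = ∑ⱼ σᵢⱼ Ḟʲ` with vanishing initial
conditions: `uᵢ(t,x) = ∫₀ᵗ ∫ G(t-r, x-y) ∑ⱼ σᵢⱼ Mʲ(dr,dy)` almost surely, where `Mʲ` is the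
martingale measure of `Fʲ`. -/
def IsSolution {k d : ℕ} {Ω : Type*} [MeasurableSpace Ω] (μ : Measure (E k)) (P : Measure Ω)
    (F : Test k → Ω → E d) (σ : Matrix (Fin d) (Fin d) ℝ) (T : ℝ) (u : ℝ → E k → Ω → E d) : Prop :=
  ∀ t ∈ Icc 0 T, ∀ x : E k, ∃ I : Fin d → Ω → ℝ,
    (∀ j, IsStochIntegral μ P (fun φ ω => F φ ω j) (waveIntegrand t x) (I j)) ∧
    ∀ i, (fun ω => u t x ω i) =ᵐ[P] fun ω => ∑ j, σ i j * I j ω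

/-! ### Densities -/

/-- The measure `ν` has the continuous density `p` with respect to Lebesgue measure. -/
def HasContDensity {V : Type*} [MeasureSpace V] [TopologicalSpace V] (ν : Measure V)
    (p : V → ℝ) : Prop :=
  Continuous p ∧ (∀ z, 0 ≤ p z) ∧ ν = volume.withDensity (fun z => ENNReal.ofReal (p z))

/-- The cube `[-L, L]ⁿ`. -/
def cube (n : ℕ) (L : ℝ) : Set (E n) := {z | ∀ i, z i ∈ Icc (-L) L}

end StochWave

open StochWave

/-! Write `u(t,x) = σ X`, where the components of `X` are the scalar stochastic integrals. They are
jointly Gaussian, independent and of equal variance, so all reduces to three numbers: the variances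
`v₁`, `v₂` at the two points and the covariance `r`, that is, `waveCov`. By isometry these are inner
products in L²(dr μ(dξ)) of the explicit Fourier transforms `waveFourier`.

Put δ = |t-s| + ‖x-y‖. The pair `(X, Y)` has covariance made of the blocks `v₁ 1`, `r 1`, `v₂ 1`,
and `Y - (r/v₁) X` is independent of `X` with variance w = v₂ - r²/v₁. Two estimates give (a): w ≥ c
δ^(2-β) bounds the normalising factor, and v₁ + v₂ - 2r ≤ C δ^(2-β) bounds the exponent through a
Cauchy-Schwarz inequality (`sq_div_add_le`). Bounds on `v₁` from both sides give (b).

The upper estimate (`HypBeta.lintegral_increment_le`) uses that the difference of the transforms is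
at most min(δ, 2/‖ξ‖), followed by scaling. The lower one (`HypBeta.le_lintegral_comb`) integrates
|a ĝ₁ + b ĝ₂|² in time, where ĝ₁, ĝ₂ are the transforms at the two points. At high frequency this is
at least a multiple of (a² + b² + 2abz)/‖ξ‖² with z = cos(ξ·(x-y)) cos((t-s)‖ξ‖). There is a ball of
frequencies of size 1/δ on which z² ≤ 1/2, so the form is at least a²/2 there, and the weighted mass
of the ball is of order δ^(2-β). -/

namespace StochWave

/-! ### The Fourier transform of the wave kernel -/

/-- `τ ↦ sin (τρ) / ρ`, read as `τ` at `ρ = 0`. -/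
noncomputable def waveAmp (τ ρ : ℝ) : ℝ := τ * Real.sinc (τ * ρ)

theorem waveAmp_eq (τ : ℝ) {ρ : ℝ} (hρ : ρ ≠ 0) : waveAmp τ ρ = Real.sin (τ * ρ) / ρ := by
  rw [waveAmp]
  rcases eq_or_ne τ 0 with rfl | h
  · simp
  · rw [Real.sinc_of_ne_zero (mul_ne_zero h hρ)]
    field_simp

/-- The Fourier transform of `G(t - r, x - ·) 1_{r ≤ t}` in the variable `ξ`. -/
noncomputable def waveFourier {k : ℕ} (t : ℝ) (x : E k) (r : ℝ) (ξ : E k) : ℂ :=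
  Complex.exp (-(Complex.I * (inner ℝ ξ x : ℝ))) * (waveAmp (max (t - r) 0) ‖ξ‖ : ℝ)

/-- Truncating `t - r` at zero encodes the indicator of r ≤ t without a jump, because the amplitude
vanishes at zero elapsed time. -/
theorem continuous_waveFourier {k : ℕ} (t : ℝ) (x : E k) :
    Continuous fun p : ℝ × E k => waveFourier t x p.1 p.2 := by
  unfold waveFourier waveAmp
  fun_prop

theorem waveFourier_of_le {k : ℕ} {t r : ℝ} (h : t ≤ r) (x ξ : E k) :
    waveFourier t x r ξ = 0 := by
  simp [waveFourier, waveAmp, max_eq_right (sub_nonpos.2 h)]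

theorem norm_exp_neg_I_mul (a : ℝ) : ‖Complex.exp (-(Complex.I * (a : ℝ)))‖ = 1 := by
  rw [Complex.norm_exp]
  simp

theorem norm_exp_neg_I_mul_sub_le (a b : ℝ) :
    ‖Complex.exp (-(Complex.I * (a : ℝ))) - Complex.exp (-(Complex.I * (b : ℝ)))‖ ≤ |a - b| := by
  have h : Complex.exp (-(Complex.I * (a : ℝ))) - Complex.exp (-(Complex.I * (b : ℝ))) =
      Complex.exp (-(Complex.I * (b : ℝ))) * (Complex.exp (Complex.I * ((b - a : ℝ) : ℂ)) - 1) := by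
    rw [mul_sub, ← Complex.exp_add, mul_one]
    congr 2
    push_cast
    ring
  rw [h, norm_mul, norm_exp_neg_I_mul, one_mul, abs_sub_comm]
  exact Real.norm_exp_I_mul_ofReal_sub_one_le

/-- The amplitude is 1-Lipschitz in time. The phase moves by at most ‖ξ‖ ‖x-y‖, and the amplitude,
at most 1/‖ξ‖, absorbs the factor ‖ξ‖. -/
theorem norm_waveFourier_sub_le {k : ℕ} (t s : ℝ) (x y : E k) (r : ℝ) (ξ : E k) :
    ‖waveFourier t x r ξ - waveFourier s y r ξ‖ ≤ |t - s| + ‖x - y‖ := by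
  set a := max (t - r) 0
  set b := max (s - r) 0
  have hab : |a - b| ≤ |t - s| := by
    have := abs_max_sub_max_le_abs (t - r) (s - r) 0
    simpa using this
  rcases eq_or_ne ξ 0 with rfl | hξ
  · have : waveFourier t x r 0 - waveFourier s y r 0 = ((a - b : ℝ) : ℂ) := by
      simp [waveFourier, waveAmp, a, b]
    rw [this, Complex.norm_real]
    exact hab.trans (le_add_of_nonneg_right (norm_nonneg _))
  have hρ : 0 < ‖ξ‖ := norm_pos_iff.2 hξ
  have h1 : waveFourier t x r ξ - waveFourier s y r ξ =
      Complex.exp (-(Complex.I * (inner ℝ ξ x : ℝ))) *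
        ((waveAmp a ‖ξ‖ - waveAmp b ‖ξ‖ : ℝ) : ℂ) +
      (Complex.exp (-(Complex.I * (inner ℝ ξ x : ℝ))) -
        Complex.exp (-(Complex.I * (inner ℝ ξ y : ℝ)))) * (waveAmp b ‖ξ‖ : ℝ) := by
    simp only [waveFourier, a, b]
    push_cast
    ring
  rw [h1]
  refine (norm_add_le _ _).trans (add_le_add ?_ ?_)
  · rw [norm_mul, norm_exp_neg_I_mul, one_mul, Complex.norm_real, waveAmp_eq _ hρ.ne',
      waveAmp_eq _ hρ.ne', ← sub_div, Real.norm_eq_abs, abs_div, abs_of_pos hρ, div_le_iff₀ hρ]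
    refine le_trans (Real.abs_sin_sub_sin_le _ _) ?_
    rw [← sub_mul, abs_mul, abs_of_pos hρ]
    gcongr
  · rw [norm_mul, Complex.norm_real, waveAmp_eq _ hρ.ne', Real.norm_eq_abs, abs_div, abs_of_pos hρ]
    have h2 := norm_exp_neg_I_mul_sub_le (inner ℝ ξ x : ℝ) (inner ℝ ξ y : ℝ)
    have h3 : |(inner ℝ ξ x : ℝ) - inner ℝ ξ y| ≤ ‖ξ‖ * ‖x - y‖ := by
      rw [← inner_sub_right]
      exact abs_real_inner_le_norm _ _
    calc _ ≤ (‖ξ‖ * ‖x - y‖) * (1 / ‖ξ‖) := by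
          gcongr
          · exact h2.trans h3
          · exact Real.abs_sin_le_one _
      _ = ‖x - y‖ := by field_simp

theorem norm_waveFourier_le_inv {k : ℕ} (t : ℝ) (x : E k) (r : ℝ) {ξ : E k} (hξ : ξ ≠ 0) :
    ‖waveFourier t x r ξ‖ ≤ 1 / ‖ξ‖ := by
  have hρ : 0 < ‖ξ‖ := norm_pos_iff.2 hξ
  rw [waveFourier, norm_mul, norm_exp_neg_I_mul, one_mul, Complex.norm_real, waveAmp_eq _ hρ.ne',
    Real.norm_eq_abs, abs_div, abs_of_pos hρ]
  gcongr
  exact Real.abs_sin_le_one _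

/-! ### Upper bound for the increments -/

/-- The majorant `min (1, 4 y⁻²)`, up to the choice of the cut. -/
noncomputable def cutoff (y : ℝ) : ℝ := if y ≤ 1 then 1 else 4 * y ^ (-2 : ℝ)

theorem measurable_cutoff : Measurable cutoff :=
  Measurable.ite measurableSet_Iic measurable_const (by fun_prop)

/-- Low frequencies use the Lipschitz bound, high frequencies the bound 1/‖ξ‖ on each term. The
majorant depends on δ‖ξ‖ alone up to the factor δ², ready for scaling. -/
theorem norm_waveFourier_sub_sq_le {k : ℕ} {t s : ℝ} {x y : E k} (r : ℝ) (ξ : E k) {δ : ℝ}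
    (hδ : δ = |t - s| + ‖x - y‖) :
    ‖waveFourier t x r ξ - waveFourier s y r ξ‖ ^ 2 ≤ δ ^ 2 * cutoff (δ * ‖ξ‖) := by
  have hδ0 : 0 ≤ δ := by rw [hδ]; positivity
  unfold cutoff
  split_ifs with h
  · rw [mul_one, hδ]
    gcongr
    exact norm_waveFourier_sub_le t s x y r ξ
  · have hξ : ξ ≠ 0 := by
      rintro rfl
      simp at h
    have hρ : 0 < ‖ξ‖ := norm_pos_iff.2 hξ
    have hδ1 : 0 < δ := by
      rcases hδ0.eq_or_lt with h0 | h0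
      · simp [← h0] at h
      · exact h0
    have h2 : ‖waveFourier t x r ξ - waveFourier s y r ξ‖ ≤ 2 / ‖ξ‖ := by
      refine (norm_sub_le _ _).trans ?_
      have := norm_waveFourier_le_inv t x r hξ
      have := norm_waveFourier_le_inv s y r hξ
      calc _ ≤ 1 / ‖ξ‖ + 1 / ‖ξ‖ := by gcongr
        _ = 2 / ‖ξ‖ := by ring
    calc _ ≤ (2 / ‖ξ‖) ^ 2 := by gcongr
      _ = δ ^ 2 * (4 * (δ * ‖ξ‖) ^ (-2 : ℝ)) := by
        rw [Real.rpow_neg (by positivity), Real.rpow_two]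
        field_simp
        norm_num

theorem lintegral_comp_smul {k : ℕ} {f : E k → ℝ≥0∞} (hf : Measurable f) {δ : ℝ} (hδ : 0 < δ) :
    ∫⁻ ξ, f (δ • ξ) = ENNReal.ofReal (δ ^ (-(k : ℝ))) * ∫⁻ ξ, f ξ := by
  have h := Measure.map_addHaar_smul (volume : Measure (E k)) hδ.ne'
  rw [← lintegral_map (f := f) hf (measurable_const_smul δ), h, lintegral_smul_measure]
  congr 2
  rw [abs_of_pos (by positivity), Real.rpow_neg hδ.le, Real.rpow_natCast]
  simp

/-- In polar coordinates the integrand is y^(β-1) near zero, which needs β > 0, and 4 y^(β-3) at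
infinity, which needs β < 2. -/
theorem integrable_cutoff_mul_rpow {k : ℕ} {β : ℝ} (h0 : 0 < β) (h2 : β < 2) (hk : 0 < k) :
    Integrable fun ξ : E k => cutoff ‖ξ‖ * ‖ξ‖ ^ (-(k : ℝ) + β) := by
  have : NeZero k := ⟨hk.ne'⟩
  rw [integrable_fun_norm_addHaar volume (f := fun y => cutoff y * y ^ (-(k : ℝ) + β))]
  have hd : Module.finrank ℝ (E k) = k := by simp
  rw [hd]
  have he : ∀ y ∈ Ioi (0 : ℝ), y ^ (k - 1) • (cutoff y * y ^ (-(k : ℝ) + β)) =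
      cutoff y * y ^ (β - 1) := by
    intro y hy
    have hy : 0 < y := hy
    rw [smul_eq_mul, ← Real.rpow_natCast, mul_left_comm, ← Real.rpow_add hy, Nat.cast_sub hk]
    congr 2
    push_cast
    ring
  rw [integrableOn_congr_fun he measurableSet_Ioi, ← Ioc_union_Ioi_eq_Ioi zero_le_one]
  refine IntegrableOn.union ?_ ?_
  · refine IntegrableOn.congr_fun (f := fun y => y ^ (β - 1)) ?_ ?_ measurableSet_Ioc
    · rw [← intervalIntegrable_iff_integrableOn_Ioc_of_le zero_le_one]
      exact intervalIntegral.intervalIntegrable_rpow' (by linarith)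
    · intro y hy
      simp [cutoff, hy.2]
  · refine IntegrableOn.congr_fun (f := fun y => 4 * y ^ (β - 3)) ?_ ?_ measurableSet_Ioi
    · exact (integrableOn_Ioi_rpow_of_lt (by linarith) one_pos).const_mul 4
    · intro y hy
      have hy' : 0 < y := one_pos.trans hy
      simp only [cutoff, not_le.2 (show 1 < y from hy), if_false]
      rw [mul_assoc, ← Real.rpow_add hy']
      congr 2
      ring

variable {k : ℕ} {β : ℝ} {μ : Measure (E k)}

theorem HypBeta.pos_dim (h : HypBeta β μ) : 0 < k := by
  have := h.1.trans (h.2.1.trans_le (min_le_right _ _))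
  exact_mod_cast this

theorem HypBeta.lt_two (h : HypBeta β μ) : β < 2 := h.2.1.trans_le (min_le_left _ _)

theorem HypBeta.sigmaFinite (h : HypBeta β μ) : SigmaFinite μ := by
  rw [h.2.2]
  infer_instance

theorem measurable_density (k : ℕ) (β : ℝ) :
    Measurable fun ξ : E k => ENNReal.ofReal (‖ξ‖ ^ (-(k : ℝ) + β)) := by
  fun_prop

/-- Substituting δξ gives δ^(-k) from Lebesgue measure and δ^(k-β) from the spectral density; with
the prefactor δ² this makes δ^(2-β). -/
theorem HypBeta.lintegral_cutoff (h : HypBeta β μ) {δ : ℝ} (hδ : 0 < δ) :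
    ∫⁻ ξ, ENNReal.ofReal (δ ^ 2 * cutoff (δ * ‖ξ‖)) ∂μ =
      ENNReal.ofReal (δ ^ (2 - β)) *
        ∫⁻ ξ : E k, ENNReal.ofReal (cutoff ‖ξ‖ * ‖ξ‖ ^ (-(k : ℝ) + β)) := by
  have hm : Measurable fun ξ : E k => ENNReal.ofReal (cutoff ‖ξ‖ * ‖ξ‖ ^ (-(k : ℝ) + β)) :=
    ((measurable_cutoff.comp measurable_norm).mul (by fun_prop)).ennreal_ofReal
  have hm' : Measurable fun ξ : E k => ENNReal.ofReal (δ ^ 2 * cutoff (δ * ‖ξ‖)) :=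
    ((measurable_cutoff.comp (measurable_norm.const_mul δ)).const_mul _).ennreal_ofReal
  rw [h.2.2, lintegral_withDensity_eq_lintegral_mul _ (measurable_density k β) hm']
  have he : ∀ ξ : E k, ((fun ξ : E k => ENNReal.ofReal (‖ξ‖ ^ (-(k : ℝ) + β))) *
      (fun ξ => ENNReal.ofReal (δ ^ 2 * cutoff (δ * ‖ξ‖))) : E k → ℝ≥0∞) ξ =
      ENNReal.ofReal (δ ^ (2 + (k : ℝ) - β)) *
        ENNReal.ofReal (cutoff ‖δ • ξ‖ * ‖δ • ξ‖ ^ (-(k : ℝ) + β)) := by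
    intro ξ
    rw [Pi.mul_apply, ← ENNReal.ofReal_mul (by positivity), ← ENNReal.ofReal_mul (by positivity),
      norm_smul, Real.norm_of_nonneg hδ.le, Real.mul_rpow hδ.le (norm_nonneg _)]
    congr 1
    have : δ ^ 2 = δ ^ (2 + (k : ℝ) - β) * δ ^ (-(k : ℝ) + β) := by
      rw [← Real.rpow_add hδ, ← Real.rpow_two]
      congr 1
      ring
    rw [this]
    ring
  have hm'' : Measurable fun ξ : E k =>
      ENNReal.ofReal (cutoff ‖δ • ξ‖ * ‖δ • ξ‖ ^ (-(k : ℝ) + β)) :=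
    hm.comp (measurable_const_smul δ)
  rw [lintegral_congr he, lintegral_const_mul _ hm'', lintegral_comp_smul hm hδ, ← mul_assoc, ← ENNReal.ofReal_mul (by positivity),
    ← Real.rpow_add hδ]
  congr 3
  ring

/-- The measure `dr μ(dξ)` on `]0,∞[ × ℝᵏ`. -/
noncomputable def noiseMeasure (μ : Measure (E k)) : Measure (ℝ × E k) :=
  (volume.restrict (Ioi (0 : ℝ))).prod μ

theorem HypBeta.lintegral_increment_le (h : HypBeta β μ) (T : ℝ) :
    ∃ C : ℝ, 0 < C ∧ ∀ t ≤ T, ∀ s ≤ T, ∀ x y : E k,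
      ∫⁻ p, ‖waveFourier t x p.1 p.2 - waveFourier s y p.1 p.2‖ₑ ^ 2 ∂(noiseMeasure μ) ≤
        ENNReal.ofReal (C * (|t - s| + ‖x - y‖) ^ (2 - β)) := by
  have := h.sigmaFinite
  set J := ∫⁻ ξ : E k, ENNReal.ofReal (cutoff ‖ξ‖ * ‖ξ‖ ^ (-(k : ℝ) + β)) with hJ
  have hJ' : J ≠ ∞ :=
    (integrable_cutoff_mul_rpow h.1 h.lt_two h.pos_dim).lintegral_lt_top.ne
  -- The integrand vanishes for r ≥ T, so the time integral costs at most the length `max T 1`. The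
  -- maximum and the `+ 1` only ensure positivity.
  refine ⟨max T 1 * (J.toReal + 1), by positivity, fun t ht s hs x y => ?_⟩
  have hβ := h.lt_two
  set δ := |t - s| + ‖x - y‖ with hδ
  rcases (show 0 ≤ δ by positivity).eq_or_lt with h0 | h0
  · have hz : ∀ p : ℝ × E k, ‖waveFourier t x p.1 p.2 - waveFourier s y p.1 p.2‖ₑ ^ 2 = 0 := by
      intro p
      have := norm_waveFourier_sub_le t s x y p.1 p.2
      rw [← hδ, ← h0] at this
      simp [norm_le_zero_iff.1 this]
    simp [hz]
  have hm : Measurable fun p : ℝ × E k =>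
      ‖waveFourier t x p.1 p.2 - waveFourier s y p.1 p.2‖ₑ ^ 2 :=
    (((continuous_waveFourier t x).sub (continuous_waveFourier s y)).measurable.enorm).pow_const 2
  rw [noiseMeasure, lintegral_prod _ hm.aemeasurable]
  have hb : ∀ r ∈ Ioi (0 : ℝ), ∫⁻ ξ, ‖waveFourier t x r ξ - waveFourier s y r ξ‖ₑ ^ 2 ∂μ ≤
      (Ioc 0 (max T 1)).indicator (fun _ => ENNReal.ofReal (δ ^ (2 - β)) * J) r := by
    intro r hr
    by_cases hrT : r ≤ max T 1
    · rw [indicator_of_mem (show r ∈ Ioc 0 (max T 1) from ⟨hr, hrT⟩), hJ, ← h.lintegral_cutoff h0]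
      refine lintegral_mono fun ξ => ?_
      rw [← ofReal_norm, ← ENNReal.ofReal_pow (norm_nonneg _)]
      exact ENNReal.ofReal_le_ofReal (norm_waveFourier_sub_sq_le r ξ hδ)
    · have hT : T ≤ r := (le_max_left _ _).trans (not_le.1 hrT).le
      simp [waveFourier_of_le (ht.trans hT), waveFourier_of_le (hs.trans hT)]
  refine (setLIntegral_mono' measurableSet_Ioi hb).trans ?_
  refine (setLIntegral_le_lintegral _ _).trans ?_
  rw [lintegral_indicator_const measurableSet_Ioc, Real.volume_Ioc, sub_zero]
  rw [← ENNReal.ofReal_toReal hJ', ← ENNReal.ofReal_mul (by positivity),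
    ← ENNReal.ofReal_mul (by positivity)]
  apply ENNReal.ofReal_le_ofReal
  rw [ENNReal.toReal_ofReal ENNReal.toReal_nonneg]
  have : 0 ≤ δ ^ (2 - β) * max T 1 := by positivity
  nlinarith

end StochWave

namespace StochWave

/-! ### Lower bound for linear combinations -/

/-- The mean of the square is (A² + B²)/2. The oscillating remainder is at most 3(A² + B²)/(4ρ), so
sρ ≥ 3 leaves half of the main term. -/
theorem le_integral_sin_cos_sq (A B : ℝ) {s ρ : ℝ} (hρ : 0 < ρ) (hs : 3 ≤ s * ρ) :
    s / 4 * (A ^ 2 + B ^ 2) ≤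
      ∫ τ in (0 : ℝ)..s, (A * Real.sin (τ * ρ) + B * Real.cos (τ * ρ)) ^ 2 := by
  have hd : ∀ τ : ℝ, HasDerivAt (fun τ => (A ^ 2 + B ^ 2) * τ / 2 +
      (B ^ 2 - A ^ 2) * Real.sin (2 * (τ * ρ)) / (4 * ρ) -
      A * B * Real.cos (2 * (τ * ρ)) / (2 * ρ))
      ((A * Real.sin (τ * ρ) + B * Real.cos (τ * ρ)) ^ 2) τ := by
    intro τ
    have h0 : HasDerivAt (fun τ : ℝ => 2 * (τ * ρ)) (2 * ρ) τ := by
      simpa using ((hasDerivAt_id τ).mul_const ρ).const_mul 2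
    have h1 := ((((hasDerivAt_id τ).const_mul (A ^ 2 + B ^ 2)).div_const 2).add
      ((h0.sin.const_mul (B ^ 2 - A ^ 2)).div_const (4 * ρ))).sub
      ((h0.cos.const_mul (A * B)).div_const (2 * ρ))
    refine h1.congr_deriv ?_
    rw [Real.cos_two_mul, Real.sin_two_mul]
    field_simp
    have := Real.sin_sq_add_cos_sq (τ * ρ)
    linear_combination (-8 * A ^ 2) * this
  rw [intervalIntegral.integral_eq_sub_of_hasDerivAt (fun τ _ => hd τ)
    (Continuous.intervalIntegrable (by fun_prop) _ _)]
  have hs1 := Real.sin_le_one (2 * (s * ρ))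
  have hs2 := Real.neg_one_le_sin (2 * (s * ρ))
  have hc1 := Real.cos_le_one (2 * (s * ρ))
  have hc2 := Real.neg_one_le_cos (2 * (s * ρ))
  set S := Real.sin (2 * (s * ρ))
  set c := Real.cos (2 * (s * ρ))
  have e : (A ^ 2 + B ^ 2) * s / 2 + (B ^ 2 - A ^ 2) * S / (4 * ρ) - A * B * c / (2 * ρ) -
      ((A ^ 2 + B ^ 2) * 0 / 2 + (B ^ 2 - A ^ 2) * Real.sin (2 * (0 * ρ)) / (4 * ρ) -
        A * B * Real.cos (2 * (0 * ρ)) / (2 * ρ)) - s / 4 * (A ^ 2 + B ^ 2) =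
      ((A ^ 2 + B ^ 2) * (s * ρ) + (B ^ 2 - A ^ 2) * S + 2 * (A * B) * (1 - c)) / (4 * ρ) := by
    simp
    field_simp
    ring
  rw [← sub_nonneg, e]
  apply div_nonneg _ (by positivity)
  -- The numerator is exactly the sum (A²+B²)(sρ-3) + A²(1-S) + B²(1+S) + (A+B)²(1-c) +
  -- (A²+B²)(1+c).
  nlinarith [mul_nonneg (sq_nonneg A) (sub_nonneg.2 hs1),
    mul_nonneg (sq_nonneg B) (by linarith : 0 ≤ 1 + S),
    mul_nonneg (sq_nonneg (A + B)) (sub_nonneg.2 hc1),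
    mul_nonneg (add_nonneg (sq_nonneg A) (sq_nonneg B)) (sub_nonneg.2 hs),
    mul_nonneg (add_nonneg (sq_nonneg A) (sq_nonneg B)) (by linarith : 0 ≤ 1 + c)]

variable {k : ℕ} {β : ℝ} {μ : Measure (E k)}

/-- After the common phase is removed, the real and imaginary parts are each a combination of sine
and cosine of (s-r)‖ξ‖, the shape required by `le_integral_sin_cos_sq`. -/
theorem norm_comb_waveFourier_sq {t s r : ℝ} (hr : r ≤ s) (hst : s ≤ t) (x y : E k) {ξ : E k}
    (hξ : ξ ≠ 0) (a b : ℝ) :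
    ‖(a : ℂ) * waveFourier t x r ξ + b * waveFourier s y r ξ‖ ^ 2 = ‖ξ‖ ^ (-2 : ℝ) *
      (((a * Real.cos (inner ℝ ξ (x - y)) * Real.cos ((t - s) * ‖ξ‖) + b) *
          Real.sin ((s - r) * ‖ξ‖) +
        (a * Real.cos (inner ℝ ξ (x - y)) * Real.sin ((t - s) * ‖ξ‖)) *
          Real.cos ((s - r) * ‖ξ‖)) ^ 2 +
      ((a * Real.sin (inner ℝ ξ (x - y)) * Real.cos ((t - s) * ‖ξ‖)) *
          Real.sin ((s - r) * ‖ξ‖) +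
        (a * Real.sin (inner ℝ ξ (x - y)) * Real.sin ((t - s) * ‖ξ‖)) *
          Real.cos ((s - r) * ‖ξ‖)) ^ 2) := by
  have hρ : 0 < ‖ξ‖ := norm_pos_iff.2 hξ
  set θ : ℝ := inner ℝ ξ (x - y) with hθ
  have h1 : (a : ℂ) * waveFourier t x r ξ + b * waveFourier s y r ξ =
      Complex.exp (-(Complex.I * (inner ℝ ξ y : ℝ))) *
        (Complex.exp (((-θ : ℝ) : ℂ) * Complex.I) * ((a * waveAmp (t - r) ‖ξ‖ : ℝ) : ℂ) +
          ((b * waveAmp (s - r) ‖ξ‖ : ℝ) : ℂ)) := by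
    rw [mul_add, ← mul_assoc, ← Complex.exp_add, hθ, inner_sub_right, waveFourier, waveFourier,
      max_eq_left (by linarith), max_eq_left (by linarith)]
    have : -(Complex.I * ((inner ℝ ξ y : ℝ) : ℂ)) +
        ((-((inner ℝ ξ x : ℝ) - (inner ℝ ξ y : ℝ)) : ℝ) : ℂ) * Complex.I =
        -(Complex.I * ((inner ℝ ξ x : ℝ) : ℂ)) := by
      push_cast
      ring
    rw [this]
    push_cast
    ring
  rw [h1, norm_mul, norm_exp_neg_I_mul, one_mul, waveAmp_eq _ hρ.ne', waveAmp_eq _ hρ.ne',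
    ← Complex.normSq_eq_norm_sq, Complex.normSq_apply]
  simp only [Complex.add_re, Complex.add_im, Complex.re_mul_ofReal, Complex.im_mul_ofReal,
    Complex.exp_ofReal_mul_I_re, Complex.exp_ofReal_mul_I_im, Complex.ofReal_re, Complex.ofReal_im,
    Real.cos_neg, Real.sin_neg]
  have h2 : (t - r) * ‖ξ‖ = (t - s) * ‖ξ‖ + (s - r) * ‖ξ‖ := by ring
  rw [h2, Real.sin_add, Real.rpow_neg hρ.le, Real.rpow_two]
  field_simp
  ring

/-- Only r ≤ s is kept, where both waves are active. The squared coefficients of the real and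
imaginary parts add up to a² + b² + 2abz. -/
theorem le_lintegral_time {t s : ℝ} (hs : 0 < s) (hst : s ≤ t) (x y : E k) {ξ : E k}
    (hξ : 3 ≤ s * ‖ξ‖) (a b : ℝ) :
    ENNReal.ofReal (s / 4 * (a ^ 2 + b ^ 2 + 2 * a * b *
      (Real.cos (inner ℝ ξ (x - y)) * Real.cos ((t - s) * ‖ξ‖))) * ‖ξ‖ ^ (-2 : ℝ)) ≤
    ∫⁻ r in Ioi (0 : ℝ), ‖(a : ℂ) * waveFourier t x r ξ + b * waveFourier s y r ξ‖ₑ ^ 2 := by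
  have hξ0 : ξ ≠ 0 := by
    rintro rfl
    norm_num at hξ
  have hρ : 0 < ‖ξ‖ := norm_pos_iff.2 hξ0
  set cθ := Real.cos (inner ℝ ξ (x - y)) with hcθ
  set sθ := Real.sin (inner ℝ ξ (x - y)) with hsθ
  set ch := Real.cos ((t - s) * ‖ξ‖) with hch
  set sh := Real.sin ((t - s) * ‖ξ‖) with hsh
  set f : ℝ → ℝ := fun τ => ((a * cθ * ch + b) * Real.sin (τ * ‖ξ‖) +
    (a * cθ * sh) * Real.cos (τ * ‖ξ‖)) ^ 2 with hf
  set g : ℝ → ℝ := fun τ => ((a * sθ * ch) * Real.sin (τ * ‖ξ‖) +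
    (a * sθ * sh) * Real.cos (τ * ‖ξ‖)) ^ 2 with hg
  have hfc : Continuous f := by fun_prop
  have hgc : Continuous g := by fun_prop
  have hpos : ∀ r, 0 ≤ ‖ξ‖ ^ (-2 : ℝ) * (f (s - r) + g (s - r)) := fun r => by positivity
  have hcont : Continuous fun r => ‖ξ‖ ^ (-2 : ℝ) * (f (s - r) + g (s - r)) := by fun_prop
  have h1 : ∫⁻ r in Ioc (0 : ℝ) s, ENNReal.ofReal (‖ξ‖ ^ (-2 : ℝ) * (f (s - r) + g (s - r))) ≤
      ∫⁻ r in Ioi (0 : ℝ), ‖(a : ℂ) * waveFourier t x r ξ + b * waveFourier s y r ξ‖ₑ ^ 2 := by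
    refine le_trans (le_of_eq ?_) (lintegral_mono_set (Ioc_subset_Ioi_self (a := s)))
    refine setLIntegral_congr_fun measurableSet_Ioc fun r hr => ?_
    rw [← norm_comb_waveFourier_sq hr.2 hst x y hξ0 a b, ENNReal.ofReal_pow (norm_nonneg _),
      ofReal_norm]
  refine le_trans ?_ h1
  rw [← ofReal_integral_eq_lintegral_ofReal
    ((hcont.integrableOn_Icc (a := 0) (b := s)).mono_set Ioc_subset_Icc_self)
    (Eventually.of_forall hpos), ← intervalIntegral.integral_of_le hs.le]
  apply ENNReal.ofReal_le_ofReal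
  rw [intervalIntegral.integral_const_mul, mul_comm]
  apply mul_le_mul_of_nonneg_left _ (by positivity)
  have h2 : ∫ r in (0 : ℝ)..s, (f (s - r) + g (s - r)) =
      (∫ τ in (0 : ℝ)..s, f τ) + ∫ τ in (0 : ℝ)..s, g τ := by
    rw [intervalIntegral.integral_comp_sub_left (fun τ => f τ + g τ) s,
      intervalIntegral.integral_add (hfc.intervalIntegrable _ _) (hgc.intervalIntegrable _ _)]
    simp
  rw [h2]
  have h3 := le_integral_sin_cos_sq (a * cθ * ch + b) (a * cθ * sh) hρ hξ
  have h4 := le_integral_sin_cos_sq (a * sθ * ch) (a * sθ * sh) hρ hξ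
  refine le_trans (le_of_eq ?_) (add_le_add h3 h4)
  have e1 : sθ ^ 2 = 1 - cθ ^ 2 := by rw [hsθ, hcθ, Real.sin_sq]
  have e2 : sh ^ 2 = 1 - ch ^ 2 := by rw [hsh, hch, Real.sin_sq]
  simp only [mul_pow, e1, e2]
  ring

/-- Near a zero of the cosine, the sine squared is at least (1 - 1/8)². The freedom in `n` lets the
frequency be as high as wanted. -/
theorem half_le_sin_sq (n : ℕ) {v : ℝ} (hv : |v - (Real.pi / 2 + n * Real.pi)| ≤ 1 / 2) :
    1 / 2 ≤ Real.sin v ^ 2 := by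
  set u := v - (Real.pi / 2 + n * Real.pi) with hu
  have h1 : v = (u + Real.pi / 2) + n * Real.pi := by rw [hu]; ring
  have h2 : Real.sin v ^ 2 = Real.cos u ^ 2 := by
    rw [h1, Real.sin_add_nat_mul_pi, Real.sin_add_pi_div_two, mul_pow, ← pow_mul, mul_comm n 2,
      pow_mul]
    simp
  have h3 := Real.one_sub_sq_div_two_le_cos (x := u)
  have h4 : u ^ 2 ≤ (1 / 2) ^ 2 := sq_le_sq' (abs_le.1 hv).1 (abs_le.1 hv).2
  rw [h2]
  nlinarith

/-- On the ball ‖ξ‖ is comparable to 1/L, so the weighted density is of order L^(k+2-β), and the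
volume is of order L^(-k). The condition m ≥ 1 keeps the ball away from the origin. -/
theorem HypBeta.le_setLIntegral_ball (h : HypBeta β μ) {m : ℝ} (hm : 1 ≤ m) :
    ∃ c : ℝ, 0 < c ∧ ∀ L : ℝ, 0 < L → ∀ e : E k, ‖e‖ = 1 →
      ENNReal.ofReal (c * L ^ (2 - β)) ≤
        ∫⁻ ξ in Metric.ball ((m / L) • e) (1 / (2 * L)), ENNReal.ofReal (‖ξ‖ ^ (-2 : ℝ)) ∂μ := by
  have : NeZero k := ⟨h.pos_dim.ne'⟩
  set V := (volume (Metric.ball (0 : E k) 1)) with hV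
  have hV0 : 0 < V := Metric.measure_ball_pos _ _ one_pos
  have hV1 : V ≠ ∞ := measure_ball_lt_top.ne
  have hVr : 0 < V.toReal := ENNReal.toReal_pos hV0.ne' hV1
  have hβ := h.lt_two
  refine ⟨(m + 1) ^ (β - k - 2) * (1 / 2) ^ k * V.toReal, by positivity, fun L hL e he => ?_⟩
  have hexp : β - (k : ℝ) - 2 ≤ 0 := by
    have : (0 : ℝ) ≤ k := Nat.cast_nonneg k
    linarith
  have hmeas : Measurable fun ξ : E k => ENNReal.ofReal (‖ξ‖ ^ (-2 : ℝ)) := by fun_prop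
  rw [h.2.2, setLIntegral_withDensity_eq_setLIntegral_mul _ (measurable_density k β) hmeas
    measurableSet_ball]
  have hb : ∀ ξ ∈ Metric.ball ((m / L) • e) (1 / (2 * L)),
      ENNReal.ofReal (((m + 1) / L) ^ (β - k - 2)) ≤
      ((fun ξ : E k => ENNReal.ofReal (‖ξ‖ ^ (-(k : ℝ) + β))) *
        (fun ξ => ENNReal.ofReal (‖ξ‖ ^ (-2 : ℝ))) : E k → ℝ≥0∞) ξ := by
    intro ξ hξ
    have hn : ‖(m / L) • e‖ = m / L := by
      rw [norm_smul, he, mul_one, Real.norm_of_nonneg (by positivity)]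
    have h1 : |‖ξ‖ - m / L| < 1 / (2 * L) := by
      rw [← hn]
      exact (abs_norm_sub_norm_le _ _).trans_lt (mem_ball_iff_norm.1 hξ)
    rw [abs_lt] at h1
    have e1 : (1 : ℝ) / (2 * L) = 1 / 2 / L := by field_simp
    have h2 : 1 / 2 / L ≤ m / L - 1 / 2 / L := by
      rw [← sub_div]
      gcongr
      linarith
    have hpos : 0 < ‖ξ‖ := by
      have : 0 < 1 / 2 / L := by positivity
      linarith [h1.1]
    have h3 : ‖ξ‖ ≤ (m + 1) / L := by
      have : (m + 1) / L = m / L + 1 / 2 / L + 1 / 2 / L := by ring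
      have : 0 < 1 / 2 / L := by positivity
      linarith [h1.2]
    rw [Pi.mul_apply, ← ENNReal.ofReal_mul (by positivity), ← Real.rpow_add hpos]
    apply ENNReal.ofReal_le_ofReal
    have : -(k : ℝ) + β + -2 = β - k - 2 := by ring
    rw [this]
    exact Real.rpow_le_rpow_of_nonpos hpos h3 hexp
  refine le_trans (le_of_eq ?_) (setLIntegral_mono' measurableSet_ball hb)
  rw [setLIntegral_const, Measure.addHaar_ball _ _ (by positivity), finrank_euclideanSpace_fin,
    ← hV, ← ENNReal.ofReal_toReal hV1, ← ENNReal.ofReal_mul (by positivity),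
    ← ENNReal.ofReal_mul (by positivity), ENNReal.toReal_ofReal ENNReal.toReal_nonneg]
  congr 1
  rw [Real.div_rpow (by linarith) hL.le]
  have : L ^ (2 - β) = (L ^ (β - k - 2))⁻¹ * (L ^ k)⁻¹ := by
    rw [← Real.rpow_natCast L k, ← Real.rpow_neg hL.le, ← Real.rpow_neg hL.le,
      ← Real.rpow_add hL]
    congr 1
    ring
  rw [this]
  field_simp
  rw [← mul_pow]
  congr 1
  field_simp

theorem sq_mul_one_sub_le (a b c : ℝ) : a ^ 2 * (1 - c ^ 2) ≤ a ^ 2 + b ^ 2 + 2 * a * b * c := by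
  nlinarith [sq_nonneg (b + a * c)]

/-- The number `q` stands for either coefficient: the argument needs s ≤ t, and the general case
exchanges the two points and hence the roles of `a` and `b`. -/
theorem HypBeta.le_lintegral_comb_of_le (h : HypBeta β μ) {t₀ : ℝ} (ht₀ : 0 < t₀) (R : ℝ) :
    ∃ c : ℝ, 0 < c ∧ ∀ s t : ℝ, t₀ ≤ s → s ≤ t → t - s ≤ R → ∀ x y : E k, ‖x - y‖ ≤ R →
      ∀ a b q : ℝ, (∀ z, q ^ 2 * (1 - z ^ 2) ≤ a ^ 2 + b ^ 2 + 2 * a * b * z) →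
      ENNReal.ofReal (c * q ^ 2 * ((t - s) + ‖x - y‖) ^ (2 - β)) ≤
        ∫⁻ p, ‖(a : ℂ) * waveFourier t x p.1 p.2 + b * waveFourier s y p.1 p.2‖ₑ ^ 2
          ∂(noiseMeasure μ) := by
  have := h.sigmaFinite
  have hβ := h.lt_two
  -- With this `n`, every ξ in the ball has ‖ξ‖ ≥ (m-1)/L ≥ 3/t₀ because L ≤ max R 1; this yields
  -- the condition 3 ≤ s‖ξ‖.
  obtain ⟨n, hn⟩ := exists_nat_ge (3 * max R 1 / t₀ + 1)
  set m := Real.pi / 2 + n * Real.pi with hm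
  have hnm : (n : ℝ) ≤ m := by
    have := Real.pi_gt_three
    have : (0 : ℝ) ≤ n := Nat.cast_nonneg n
    rw [hm]
    nlinarith
  have hm3 : 3 * max R 1 / t₀ + 1 ≤ m := hn.trans hnm
  have hm1 : 1 ≤ m := by
    have : 0 ≤ 3 * max R 1 / t₀ := by positivity
    linarith
  obtain ⟨c, hc, H⟩ := h.le_setLIntegral_ball hm1
  -- Here t₀/8 is the t₀/4 of the time integral times the 1/2 from z² ≤ 1/2, and the power of 1/2
  -- comes from L ≥ δ/2.
  refine ⟨t₀ / 8 * c * (1 / 2) ^ (2 - β), by positivity, ?_⟩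
  intro s t hs hst hR x y hxy a b q hq
  rcases (show 0 ≤ (t - s) + ‖x - y‖ from add_nonneg (sub_nonneg.2 hst) (norm_nonneg _)).eq_or_lt
    with h0 | h0
  · rw [← h0, Real.zero_rpow (by linarith)]
    simp
  set δ := (t - s) + ‖x - y‖ with hδ
  have hs0 : 0 < s := ht₀.trans_le hs
  -- a ball of frequencies on which `c² ≤ 1 / 2`
  obtain ⟨L, e, hLδ, hLR, he, hball⟩ : ∃ (L : ℝ) (e : E k), δ / 2 ≤ L ∧ L ≤ max R 1 ∧ ‖e‖ = 1 ∧
      ∀ ξ ∈ Metric.ball ((m / L) • e) (1 / (2 * L)),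
        (Real.cos (inner ℝ ξ (x - y)) * Real.cos ((t - s) * ‖ξ‖)) ^ 2 ≤ 1 / 2 := by
    -- `L` is the larger of the two separations. If it is the time lag, cos((t-s)‖ξ‖) is made small
    -- and any direction serves; otherwise the ball lies along x - y and cos(ξ·(x-y)) is small.
    rcases le_total ‖x - y‖ (t - s) with hle | hle
    · have : NeZero k := ⟨h.pos_dim.ne'⟩
      obtain ⟨e, he⟩ := exists_norm_eq (E k) (zero_le_one)
      have hL : 0 < t - s := by linarith
      refine ⟨t - s, e, by linarith, hR.trans (le_max_left _ _), he, fun ξ hξ => ?_⟩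
      have hnm : ‖(m / (t - s)) • e‖ = m / (t - s) := by
        rw [norm_smul, he, mul_one, Real.norm_of_nonneg (by positivity)]
      have h1 : |‖ξ‖ - m / (t - s)| < 1 / (2 * (t - s)) := by
        rw [← hnm]
        exact (abs_norm_sub_norm_le _ _).trans_lt (mem_ball_iff_norm.1 hξ)
      have h2 : |(t - s) * ‖ξ‖ - m| ≤ 1 / 2 := by
        have : (t - s) * ‖ξ‖ - m = (t - s) * (‖ξ‖ - m / (t - s)) := by field_simp
        rw [this, abs_mul, abs_of_pos hL]
        calc _ ≤ (t - s) * (1 / (2 * (t - s))) := by gcongr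
          _ = 1 / 2 := by field_simp
      have h3 := half_le_sin_sq n h2
      rw [mul_pow]
      have h4 := Real.sin_sq_add_cos_sq ((t - s) * ‖ξ‖)
      have h5 := Real.cos_sq_le_one (inner ℝ ξ (x - y))
      nlinarith [sq_nonneg (Real.cos ((t - s) * ‖ξ‖))]
    · have hL : 0 < ‖x - y‖ := by linarith
      refine ⟨‖x - y‖, ‖x - y‖⁻¹ • (x - y), by linarith, hxy.trans (le_max_left _ _), ?_,
        fun ξ hξ => ?_⟩
      · rw [norm_smul, norm_inv, norm_norm, inv_mul_cancel₀ hL.ne']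
      have h2 : |inner ℝ ξ (x - y) - m| ≤ 1 / 2 := by
        have : inner ℝ ξ (x - y) - m =
            inner ℝ (ξ - (m / ‖x - y‖) • ‖x - y‖⁻¹ • (x - y)) (x - y) := by
          rw [inner_sub_left, real_inner_smul_left, real_inner_smul_left,
            real_inner_self_eq_norm_sq]
          field_simp
        rw [this]
        refine (abs_real_inner_le_norm _ _).trans ?_
        calc _ ≤ (1 / (2 * ‖x - y‖)) * ‖x - y‖ := by
              gcongr
              exact (mem_ball_iff_norm.1 hξ).le
          _ = 1 / 2 := by field_simp
      have h3 := half_le_sin_sq n h2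
      rw [mul_pow]
      have h4 := Real.sin_sq_add_cos_sq (inner ℝ ξ (x - y))
      have h5 := Real.cos_sq_le_one ((t - s) * ‖ξ‖)
      nlinarith [sq_nonneg (Real.cos (inner ℝ ξ (x - y)))]
  have hL : 0 < L := by linarith
  have hmeas : Measurable fun p : ℝ × E k =>
      ‖(a : ℂ) * waveFourier t x p.1 p.2 + b * waveFourier s y p.1 p.2‖ₑ ^ 2 :=
    (((continuous_const.mul (continuous_waveFourier t x)).add
      (continuous_const.mul (continuous_waveFourier s y))).measurable.enorm).pow_const 2
  rw [noiseMeasure, lintegral_prod_symm _ hmeas.aemeasurable]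
  calc ENNReal.ofReal (t₀ / 8 * c * (1 / 2) ^ (2 - β) * q ^ 2 * δ ^ (2 - β))
      ≤ ENNReal.ofReal (t₀ / 8 * q ^ 2) * ENNReal.ofReal (c * L ^ (2 - β)) := by
        rw [← ENNReal.ofReal_mul (by positivity)]
        apply ENNReal.ofReal_le_ofReal
        have : (1 / 2) ^ (2 - β) * δ ^ (2 - β) ≤ L ^ (2 - β) := by
          rw [← Real.mul_rpow (by norm_num) h0.le]
          exact Real.rpow_le_rpow (by positivity) (by linarith) (by linarith)
        calc _ = t₀ / 8 * q ^ 2 * (c * ((1 / 2) ^ (2 - β) * δ ^ (2 - β))) := by ring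
          _ ≤ _ := by gcongr
    _ ≤ ENNReal.ofReal (t₀ / 8 * q ^ 2) * ∫⁻ ξ in Metric.ball ((m / L) • e) (1 / (2 * L)),
          ENNReal.ofReal (‖ξ‖ ^ (-2 : ℝ)) ∂μ := by
        gcongr
        exact H L hL e he
    _ = ∫⁻ ξ in Metric.ball ((m / L) • e) (1 / (2 * L)),
          ENNReal.ofReal (t₀ / 8 * q ^ 2) * ENNReal.ofReal (‖ξ‖ ^ (-2 : ℝ)) ∂μ := by
        rw [lintegral_const_mul _ (by fun_prop)]
    _ ≤ ∫⁻ ξ in Metric.ball ((m / L) • e) (1 / (2 * L)), (∫⁻ r in Ioi (0 : ℝ),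
          ‖(a : ℂ) * waveFourier t x r ξ + b * waveFourier s y r ξ‖ₑ ^ 2) ∂μ := by
        refine setLIntegral_mono' measurableSet_ball fun ξ hξ => ?_
        have hnm : ‖(m / L) • e‖ = m / L := by
          rw [norm_smul, he, mul_one, Real.norm_of_nonneg (by positivity)]
        have h1 : |‖ξ‖ - m / L| < 1 / (2 * L) := by
          rw [← hnm]
          exact (abs_norm_sub_norm_le _ _).trans_lt (mem_ball_iff_norm.1 hξ)
        have h2 : 3 ≤ s * ‖ξ‖ := by
          have e1 : (1 : ℝ) / (2 * L) = 1 / 2 / L := by field_simp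
          have h3 : (m - 1) / L ≤ ‖ξ‖ := by
            have : (m - 1) / L = m / L - 1 / 2 / L - 1 / 2 / L := by ring
            have : 0 < 1 / 2 / L := by positivity
            linarith [(abs_lt.1 h1).1]
          have h4 : 3 * max R 1 / t₀ / L ≤ (m - 1) / L := by
            gcongr
            linarith
          have h5 : 3 / t₀ ≤ 3 * max R 1 / t₀ / L := by
            rw [le_div_iff₀ hL, div_mul_eq_mul_div]
            gcongr
          have h6 : 3 / t₀ ≤ ‖ξ‖ := by linarith
          calc 3 = t₀ * (3 / t₀) := by field_simp
            _ ≤ s * ‖ξ‖ := by gcongr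
        refine le_trans ?_ (le_lintegral_time hs0 hst x y h2 a b)
        rw [← ENNReal.ofReal_mul (by positivity)]
        apply ENNReal.ofReal_le_ofReal
        apply mul_le_mul_of_nonneg_right _ (by positivity)
        have h7 := hq (Real.cos (inner ℝ ξ (x - y)) * Real.cos ((t - s) * ‖ξ‖))
        have h8 := hball ξ hξ
        set z := Real.cos (inner ℝ ξ (x - y)) * Real.cos ((t - s) * ‖ξ‖)
        have h9 : q ^ 2 * (1 / 2) ≤ a ^ 2 + b ^ 2 + 2 * a * b * z :=
          le_trans (by gcongr; linarith) h7
        calc t₀ / 8 * q ^ 2 = t₀ / 4 * (q ^ 2 * (1 / 2)) := by ring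
          _ ≤ _ := by gcongr
    _ ≤ _ := setLIntegral_le_lintegral _ _

theorem HypBeta.le_lintegral_comb (h : HypBeta β μ) {t₀ : ℝ} (ht₀ : 0 < t₀) (R : ℝ) :
    ∃ c : ℝ, 0 < c ∧ ∀ t s : ℝ, t₀ ≤ t → t₀ ≤ s → |t - s| ≤ R → ∀ x y : E k, ‖x - y‖ ≤ R →
      ∀ a b : ℝ, ENNReal.ofReal (c * a ^ 2 * (|t - s| + ‖x - y‖) ^ (2 - β)) ≤
        ∫⁻ p, ‖(a : ℂ) * waveFourier t x p.1 p.2 + b * waveFourier s y p.1 p.2‖ₑ ^ 2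
          ∂(noiseMeasure μ) := by
  obtain ⟨c, hc, H⟩ := h.le_lintegral_comb_of_le ht₀ R
  refine ⟨c, hc, fun t s ht hs hR x y hxy a b => ?_⟩
  rcases le_total s t with hst | hst
  · rw [abs_of_nonneg (sub_nonneg.2 hst)] at hR ⊢
    exact H s t hs hst hR x y hxy a b a (sq_mul_one_sub_le a b)
  · rw [abs_sub_comm, abs_of_nonneg (sub_nonneg.2 hst)] at hR
    rw [abs_sub_comm, abs_of_nonneg (sub_nonneg.2 hst), norm_sub_rev]
    have := H t s ht hst hR y x (by rwa [norm_sub_rev]) b a a fun z =>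
      (sq_mul_one_sub_le a b z).trans (le_of_eq (by ring))
    simpa only [add_comm] using this

end StochWave

namespace StochWave

/-! ### Identification of Fourier transforms -/

theorem fourierInv_comp_sub_left {k : ℕ} (x : E k) (f : E k → ℂ) (η : E k) :
    (𝓕⁻ (fun y => f (x - y))) η =
      Complex.exp (((2 * Real.pi * inner ℝ x η : ℝ) : ℂ) * Complex.I) * (𝓕 f) η := by
  rw [Real.fourierInv_eq', Real.fourier_eq', ← integral_sub_left_eq_self _ volume x,
    ← integral_const_mul]
  congr 1
  funext y
  rw [sub_sub_cancel, smul_eq_mul, smul_eq_mul, ← mul_assoc, ← Complex.exp_add, inner_sub_left]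
  congr 2
  push_cast
  ring

theorem waveSymbol_neg {k : ℕ} (t : ℝ) (η : E k) : waveSymbol k t (-η) = waveSymbol k t η := by
  simp [waveSymbol]

theorem fourier_reflectAt_waveKernel {k : ℕ} (t : ℝ) (x : E k) (φ : 𝓢(E k, ℂ)) :
    (𝓕 (reflectAt x (waveKernel k t))) φ = ∫ η : E k, φ η *
      (Complex.exp (-(Complex.I * (inner ℝ ((2 * Real.pi) • η) x : ℝ))) * waveSymbol k t η) := by
  rw [TemperedDistribution.fourier_apply]
  change waveKernel k t (SchwartzMap.compCLMOfAntilipschitz (g := fun y : E k => x - y) (K := 1) ℂ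
      (by fun_prop) (by intro y z; simp [edist_sub_left]) (𝓕 φ)) = _
  rw [waveKernel_apply, ← integral_neg_eq_self]
  congr 1
  funext η
  rw [SchwartzMap.fourierInv_coe]
  change (𝓕⁻ (fun y => (𝓕 φ : 𝓢(E k, ℂ)) (x - y))) (-η) * _ = _
  have h : (𝓕 ((𝓕 φ : 𝓢(E k, ℂ)) : E k → ℂ)) (-η) = φ η := by
    have h1 : (𝓕⁻ (𝓕 φ) : 𝓢(E k, ℂ)) = φ := FourierTransform.fourierInv_fourier_eq φ
    have h2 : (𝓕⁻ (𝓕 φ) : 𝓢(E k, ℂ)) η = φ η := by rw [h1]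
    rw [SchwartzMap.fourierInv_coe, Real.fourierInv_eq_fourier_neg] at h2
    exact h2
  rw [fourierInv_comp_sub_left x (fun y => (𝓕 φ : 𝓢(E k, ℂ)) y), waveSymbol_neg, h,
    inner_neg_right, real_inner_smul_left, real_inner_comm]
  have : (((2 * Real.pi * -(inner ℝ η x) : ℝ) : ℂ) * Complex.I) =
      -(Complex.I * ((2 * Real.pi * inner ℝ η x : ℝ) : ℂ)) := by
    push_cast
    ring
  rw [this]
  ring

theorem fourier_waveIntegrand {k : ℕ} (t : ℝ) (x : E k) (r : ℝ) (φ : 𝓢(E k, ℂ)) :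
    (𝓕 (waveIntegrand t x r)) φ =
      ∫ η : E k, φ η * waveFourier t x r ((2 * Real.pi) • η) := by
  unfold waveIntegrand
  split_ifs with h
  · rw [fourier_reflectAt_waveKernel]
    simp only [waveFourier, waveAmp, max_eq_left (sub_nonneg.2 h)]
    rfl
  · simp only [waveFourier_of_le (not_le.1 h).le, mul_zero, integral_zero]
    rfl

/-- Smooth compactly supported functions are Schwartz and determine a locally integrable function
almost everywhere; continuity gives equality everywhere. -/
theorem eq_of_forall_schwartz_integral_eq {k : ℕ} {f g : E k → ℂ} (hf : Continuous f)
    (hg : Continuous g) (h : ∀ φ : 𝓢(E k, ℂ), ∫ η, φ η * f η = ∫ η, φ η * g η) : f = g := by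
  have hae : f =ᵐ[volume] g := by
    refine ae_eq_of_integral_contDiff_smul_eq hf.locallyIntegrable hg.locallyIntegrable
      fun ψ hψ hc => ?_
    have hc' : HasCompactSupport fun η => (ψ η : ℂ) := hc.comp_left Complex.ofReal_zero
    have := h (hc'.toSchwartzMap (Complex.ofRealCLM.contDiff.comp hψ))
    simp only [Complex.real_smul]
    exact this
  exact (hf.ae_eq_iff_eq volume hg).1 hae

/-- `IsStochIntegral` only asserts that some continuous transform `g` exists. Uniqueness makes it
the explicit one, so the isometry can be computed. -/
theorem HasFourier.eq_waveFourier {k : ℕ} {t : ℝ} {x : E k} {r : ℝ} {g : E k → ℂ}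
    (h : HasFourier (waveIntegrand t x r) g) : g = waveFourier t x r := by
  have hw : Continuous (waveFourier t x r) := by
    unfold waveFourier waveAmp
    fun_prop
  have hs : Continuous fun η : E k => (2 * Real.pi) • η := by fun_prop
  have := eq_of_forall_schwartz_integral_eq (h.1.comp hs) (hw.comp hs) fun φ => by
    simp only [Function.comp_apply]
    rw [← h.2 φ, fourier_waveIntegrand]
  funext ξ
  have h2 := congrFun this ((2 * Real.pi)⁻¹ • ξ)
  have e : (2 * Real.pi) • (2 * Real.pi)⁻¹ • ξ = ξ :=
    smul_inv_smul₀ (mul_ne_zero two_ne_zero Real.pi_ne_zero) ξ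
  simpa only [Function.comp_apply, e] using h2

/-- The integral runs over one compact set for all times, the projection of the support to space.
Joint continuity supplies the measurability needed on the product. -/
theorem continuous_spaceFourier {k : ℕ} (φ : Test k) :
    Continuous fun p : ℝ × E k => spaceFourier φ p.1 p.2 := by
  have hφ : Continuous φ := φ.continuous
  set K : Set (E k) := Prod.snd '' tsupport φ with hK
  have hKc : IsCompact K := φ.hasCompactSupport.isCompact.image continuous_snd
  have h : (fun p : ℝ × E k => spaceFourier φ p.1 p.2) = fun p => ∫ y in K,
      Complex.exp (-(Complex.I * (inner ℝ p.2 y : ℝ))) * (φ (p.1, y) : ℝ) := by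
    funext p
    rw [spaceFourier, setIntegral_eq_integral_of_forall_compl_eq_zero]
    intro y hy
    have : φ (p.1, y) = 0 := by
      by_contra hne
      exact hy ⟨(p.1, y), subset_tsupport _ hne, rfl⟩
    simp [this]
  rw [h]
  refine continuous_parametric_integral_of_continuous
    (f := fun (p : ℝ × E k) (y : E k) =>
      Complex.exp (-(Complex.I * (inner ℝ p.2 y : ℝ))) * (φ (p.1, y) : ℝ)) ?_ hKc
  unfold Function.uncurry
  fun_prop

end StochWave

namespace StochWave

/-! ### Convergence in `L²` -/

section LTwo

variable {α : Type*} [MeasurableSpace α] {ν : Measure α}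

theorem eLpNorm_two_sq {F : Type*} [NormedAddCommGroup F] (f : α → F) :
    eLpNorm f 2 ν ^ 2 = ∫⁻ a, ‖f a‖ₑ ^ 2 ∂ν := by
  have := eLpNorm_nnreal_pow_eq_lintegral (μ := ν) (f := f) (p := 2) two_ne_zero
  simpa using this

theorem tendsto_eLpNorm_two_iff {F : Type*} [NormedAddCommGroup F] {f : ℕ → α → F} :
    Tendsto (fun n => eLpNorm (f n) 2 ν) atTop (𝓝 0) ↔
      Tendsto (fun n => ∫⁻ a, ‖f n a‖ₑ ^ 2 ∂ν) atTop (𝓝 0) := by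
  simp_rw [← eLpNorm_two_sq]
  refine ⟨fun h => ?_, fun h => ?_⟩
  · simpa [Function.comp_def] using ((ENNReal.continuous_pow 2).tendsto 0).comp h
  · have := (ENNReal.continuous_rpow_const (y := 1 / 2)).continuousAt.tendsto.comp h
    simp only [Function.comp_def] at this
    rw [ENNReal.zero_rpow_of_pos (by norm_num)] at this
    refine this.congr fun n => ?_
    rw [← ENNReal.rpow_two, ← ENNReal.rpow_mul]
    norm_num

theorem integral_mul_star_eq_inner {𝕜 : Type*} [RCLike 𝕜] {f g : α → 𝕜} (hf : MemLp f 2 ν)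
    (hg : MemLp g 2 ν) :
    ∫ a, f a * starRingEnd 𝕜 (g a) ∂ν = inner 𝕜 (hg.toLp g) (hf.toLp f) := by
  rw [L2.inner_def]
  refine integral_congr_ae ?_
  filter_upwards [hf.coeFn_toLp, hg.coeFn_toLp] with a h1 h2
  rw [h1, h2, RCLike.inner_apply]

theorem tendsto_integral_mul_star {𝕜 : Type*} [RCLike 𝕜] {f g : ℕ → α → 𝕜} {f' g' : α → 𝕜}
    (hf : ∀ n, MemLp (f n) 2 ν) (hg : ∀ n, MemLp (g n) 2 ν) (hf' : MemLp f' 2 ν)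
    (hg' : MemLp g' 2 ν) (hff : Tendsto (fun n => eLpNorm (f n - f') 2 ν) atTop (𝓝 0))
    (hgg : Tendsto (fun n => eLpNorm (g n - g') 2 ν) atTop (𝓝 0)) :
    Tendsto (fun n => ∫ a, f n a * starRingEnd 𝕜 (g n a) ∂ν) atTop
      (𝓝 (∫ a, f' a * starRingEnd 𝕜 (g' a) ∂ν)) := by
  rw [integral_mul_star_eq_inner hf' hg']
  simp_rw [fun n => integral_mul_star_eq_inner (hf n) (hg n)]
  exact ((Lp.tendsto_Lp_iff_tendsto_eLpNorm'' g hg g' hg').2 hgg).inner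
    ((Lp.tendsto_Lp_iff_tendsto_eLpNorm'' f hf f' hf').2 hff)

/-- Since |e^(iu) - e^(iv)| ≤ |u - v|, convergence in L² carries characteristic functions to the
limit. This transfers Gaussianity from the noise to the stochastic integrals. -/
theorem tendsto_integral_exp [IsProbabilityMeasure ν] {Y : ℕ → α → ℝ} {Z : α → ℝ}
    (hY : ∀ n, MemLp (Y n) 2 ν) (hZ : MemLp Z 2 ν)
    (h : Tendsto (fun n => eLpNorm (Y n - Z) 2 ν) atTop (𝓝 0)) :
    Tendsto (fun n => ∫ a, Complex.exp ((Y n a : ℂ) * Complex.I) ∂ν) atTop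
      (𝓝 (∫ a, Complex.exp ((Z a : ℂ) * Complex.I) ∂ν)) := by
  have hm : ∀ {W : α → ℝ}, MemLp W 2 ν →
      AEStronglyMeasurable (fun a => Complex.exp ((W a : ℂ) * Complex.I)) ν := fun hW =>
    (by fun_prop : Continuous fun w : ℝ => Complex.exp ((w : ℂ) * Complex.I)
      ).comp_aestronglyMeasurable hW.1
  refine tendsto_integral_of_L1 _ (hm hZ) (Eventually.of_forall fun n => ?_) ?_
  · refine Integrable.of_bound (hm (hY n)) 1 (Eventually.of_forall fun a => ?_)
    rw [Complex.norm_exp_ofReal_mul_I]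
  · refine tendsto_of_tendsto_of_tendsto_of_le_of_le tendsto_const_nhds h (fun _ => zero_le)
      fun n => ?_
    refine le_trans ?_ (eLpNorm_le_eLpNorm_of_exponent_le (p := 1) (by norm_num)
      ((hY n).1.sub hZ.1))
    rw [eLpNorm_one_eq_lintegral_enorm]
    refine lintegral_mono fun a => ?_
    rw [← ofReal_norm, ← ofReal_norm]
    apply ENNReal.ofReal_le_ofReal
    have h1 := norm_exp_neg_I_mul_sub_le (-Y n a) (-Z a)
    have e : ∀ w : ℝ, -(Complex.I * ((-w : ℝ) : ℂ)) = (w : ℂ) * Complex.I := fun w => by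
      push_cast
      ring
    rw [e, e] at h1
    refine h1.trans (le_of_eq ?_)
    rw [Pi.sub_apply, Real.norm_eq_abs, neg_sub_neg, abs_sub_comm]

theorem tendsto_eLpNorm_sum {ι : Type*} [Fintype ι] (c : ι → ℝ) {Y : ℕ → ι → α → ℝ} {Z : ι → α → ℝ}
    (hY : ∀ n i, MemLp (Y n i) 2 ν) (hZ : ∀ i, MemLp (Z i) 2 ν)
    (h : ∀ i, Tendsto (fun n => eLpNorm (Y n i - Z i) 2 ν) atTop (𝓝 0)) :
    Tendsto (fun n => eLpNorm ((fun a => ∑ i, c i * Y n i a) - fun a => ∑ i, c i * Z i a) 2 ν)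
      atTop (𝓝 0) := by
  have h1 : Tendsto (fun n => ∑ i, ‖c i‖ₑ * eLpNorm (Y n i - Z i) 2 ν) atTop (𝓝 0) := by
    have : (0 : ℝ≥0∞) = ∑ i, ‖c i‖ₑ * 0 := by simp
    rw [this]
    exact tendsto_finsetSum _ fun i _ =>
      ENNReal.Tendsto.const_mul (h i) (Or.inr enorm_ne_top)
  refine tendsto_of_tendsto_of_tendsto_of_le_of_le tendsto_const_nhds h1 (fun _ => zero_le)
    fun n => ?_
  have e : ((fun a => ∑ i, c i * Y n i a) - fun a => ∑ i, c i * Z i a) =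
      ∑ i, c i • (Y n i - Z i) := by
    funext a
    simp [mul_sub, Finset.sum_sub_distrib]
  rw [e]
  refine (eLpNorm_sum_le (fun i _ => (((hY n i).sub (hZ i)).const_smul (c i)).1)
    (by norm_num)).trans ?_
  exact Finset.sum_le_sum fun i _ => eLpNorm_const_smul_le

end LTwo

/-! ### Covariances of the stochastic integrals -/

variable {k : ℕ} {β : ℝ} {μ : Measure (E k)}

/-- At time 0 the transform vanishes for r > 0, so the increment bound between times t and 0 is
already a bound on the norm. -/
theorem HypBeta.memLp_waveFourier (h : HypBeta β μ) (t : ℝ) (x : E k) :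
    MemLp (fun p : ℝ × E k => waveFourier t x p.1 p.2) 2 (noiseMeasure μ) := by
  refine ⟨(continuous_waveFourier t x).aestronglyMeasurable, ?_⟩
  obtain ⟨C, -, H⟩ := h.lintegral_increment_le (max t 0)
  have h1 := H t (le_max_left _ _) 0 (le_max_right _ _) x x
  have h2 : eLpNorm (fun p : ℝ × E k => waveFourier t x p.1 p.2) 2 (noiseMeasure μ) =
      eLpNorm (fun p : ℝ × E k => waveFourier t x p.1 p.2 - waveFourier 0 x p.1 p.2) 2
        (noiseMeasure μ) := by
    have := h.sigmaFinite
    refine eLpNorm_congr_ae ?_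
    have h3 : ∀ᵐ p ∂(noiseMeasure μ), p.1 ∈ Ioi (0 : ℝ) :=
      Measure.quasiMeasurePreserving_fst.ae (ae_restrict_mem measurableSet_Ioi)
    filter_upwards [h3] with p hp
    rw [waveFourier_of_le (le_of_lt hp), sub_zero]
  rw [h2]
  rw [← eLpNorm_two_sq] at h1
  by_contra htop
  rw [not_lt, top_le_iff] at htop
  rw [htop] at h1
  simp at h1

/-- The covariance of the scalar solutions at `(t, x)` and `(s, y)`. -/
noncomputable def waveCov (μ : Measure (E k)) (t : ℝ) (x : E k) (s : ℝ) (y : E k) : ℝ :=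
  (∫ p, waveFourier t x p.1 p.2 * starRingEnd ℂ (waveFourier s y p.1 p.2) ∂(noiseMeasure μ)).re

/-- Expanding a squared L² norm turns the frequency estimates above into estimates on `waveCov`. -/
theorem HypBeta.lintegral_comb (h : HypBeta β μ) (t : ℝ) (x : E k) (s : ℝ) (y : E k) (a b : ℝ) :
    ∫⁻ p, ‖(a : ℂ) * waveFourier t x p.1 p.2 + b * waveFourier s y p.1 p.2‖ₑ ^ 2
        ∂(noiseMeasure μ) =
      ENNReal.ofReal (a ^ 2 * waveCov μ t x t x + b ^ 2 * waveCov μ s y s y +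
        2 * a * b * waveCov μ t x s y) := by
  have ht := h.memLp_waveFourier t x
  have hs := h.memLp_waveFourier s y
  set G := ht.toLp _ with hG
  set H := hs.toLp _ with hH
  have hc : ∀ {f g : ℝ × E k → ℂ} (hf : MemLp f 2 (noiseMeasure μ))
      (hg : MemLp g 2 (noiseMeasure μ)), (∫ p, f p * starRingEnd ℂ (g p) ∂(noiseMeasure μ)).re =
      (inner ℂ (hg.toLp g) (hf.toLp f)).re := fun hf hg => by
    rw [integral_mul_star_eq_inner hf hg]
  have e : ∫⁻ p, ‖(a : ℂ) * waveFourier t x p.1 p.2 + b * waveFourier s y p.1 p.2‖ₑ ^ 2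
        ∂(noiseMeasure μ) = ENNReal.ofReal (‖(a : ℂ) • G + (b : ℂ) • H‖ ^ 2) := by
    rw [hG, hH, ← MemLp.toLp_const_smul, ← MemLp.toLp_const_smul, ← MemLp.toLp_add,
      ENNReal.ofReal_pow (norm_nonneg _), ofReal_norm, Lp.enorm_toLp, eLpNorm_two_sq]
    rfl
  rw [e]
  congr 1
  rw [waveCov, waveCov, waveCov, hc ht ht, hc hs hs, hc ht hs, ← hG, ← hH]
  have h1 := norm_add_sq (𝕜 := ℂ) ((a : ℂ) • G) ((b : ℂ) • H)
  rw [h1, norm_smul, norm_smul, mul_pow, mul_pow, inner_smul_left, inner_smul_right,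
    Complex.norm_real, Complex.norm_real, Real.norm_eq_abs, Real.norm_eq_abs, sq_abs, sq_abs,
    inner_self_eq_norm_sq_to_K, inner_self_eq_norm_sq_to_K]
  have h2 : (inner ℂ H G).re = (inner ℂ G H).re := inner_re_symm (𝕜 := ℂ) H G
  simp [← Complex.ofReal_pow, h2]
  ring

variable {d : ℕ} {Ω : Type*} [MeasurableSpace Ω] {P : Measure Ω}

theorem IsStochIntegral.exists_approx (h : HypBeta β μ) {W : Test k → Ω → ℝ} {t : ℝ} {x : E k}
    {X : Ω → ℝ} (hX : IsStochIntegral μ P W (waveIntegrand t x) X) :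
    ∃ φ : ℕ → Test k,
      (∀ n, MemLp (fun p : ℝ × E k => spaceFourier (φ n) p.1 p.2) 2 (noiseMeasure μ)) ∧
      Tendsto (fun n => eLpNorm ((fun p : ℝ × E k => spaceFourier (φ n) p.1 p.2) -
        fun p : ℝ × E k => waveFourier t x p.1 p.2) 2 (noiseMeasure μ)) atTop (𝓝 0) ∧
      Tendsto (fun n => eLpNorm (W (φ n) - X) 2 P) atTop (𝓝 0) := by
  have := h.sigmaFinite
  obtain ⟨-, g, hg, φ, h1, h2⟩ := hX
  have h3 : Tendsto (fun n => eLpNorm ((fun p : ℝ × E k => spaceFourier (φ n) p.1 p.2) -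
      fun p : ℝ × E k => waveFourier t x p.1 p.2) 2 (noiseMeasure μ)) atTop (𝓝 0) := by
    rw [tendsto_eLpNorm_two_iff]
    refine h1.congr fun n => ?_
    have hm : Measurable fun p : ℝ × E k => ‖((fun p : ℝ × E k => spaceFourier (φ n) p.1 p.2) -
        fun p : ℝ × E k => waveFourier t x p.1 p.2) p‖ₑ ^ 2 :=
      (((continuous_spaceFourier (φ n)).sub
        (continuous_waveFourier t x)).measurable.enorm).pow_const 2
    rw [noiseMeasure, lintegral_prod _ hm.aemeasurable]
    refine setLIntegral_congr_fun measurableSet_Ioi fun r hr => ?_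
    simp only [(hg r hr).eq_waveFourier, Pi.sub_apply]
  have h4 : ∀ᶠ n in atTop, eLpNorm ((fun p : ℝ × E k => spaceFourier (φ n) p.1 p.2) -
      fun p : ℝ × E k => waveFourier t x p.1 p.2) 2 (noiseMeasure μ) < ∞ :=
    h3.eventually (gt_mem_nhds ENNReal.zero_lt_top)
  obtain ⟨N, hN⟩ := eventually_atTop.1 h4
  -- Dropping the first `N` terms makes every approximant square integrable: it is the limit plus a
  -- difference of finite norm.
  refine ⟨fun n => φ (n + N), fun n => ?_, h3.comp (tendsto_add_atTop_nat N),
    h2.comp (tendsto_add_atTop_nat N)⟩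
  have h5 : MemLp ((fun p : ℝ × E k => spaceFourier (φ (n + N)) p.1 p.2) -
      fun p : ℝ × E k => waveFourier t x p.1 p.2) 2 (noiseMeasure μ) :=
    ⟨((continuous_spaceFourier _).sub (continuous_waveFourier t x)).aestronglyMeasurable,
      hN _ (Nat.le_add_left _ _)⟩
  have h6 := h5.add (h.memLp_waveFourier t x)
  rwa [sub_add_cancel] at h6

variable {F : Test k → Ω → E d}

theorem IsNoise.memLp (hF : IsNoise μ P F) (φ : Test k) (j : Fin d) :
    MemLp (fun ω => F φ ω j) 2 P :=
  ((hF.gaussian.hasGaussianLaw_eval φ).map_fun (EuclideanSpace.proj (𝕜 := ℝ) j)).memLp_two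

/-- Both sides of the covariance identity of the noise are inner products, in L²(P) and in L²(dr
μ(dξ)), so they pass to the limit along the approximants. -/
theorem IsNoise.integral_mul_eq [IsProbabilityMeasure P] (h : HypBeta β μ) (hF : IsNoise μ P F)
    {t s : ℝ} {x y : E k} {i j : Fin d} {X Y : Ω → ℝ}
    (hX : IsStochIntegral μ P (fun φ ω => F φ ω i) (waveIntegrand t x) X)
    (hY : IsStochIntegral μ P (fun φ ω => F φ ω j) (waveIntegrand s y) Y) :
    ∫ ω, X ω * Y ω ∂P = if i = j then waveCov μ t x s y else 0 := by
  have := h.sigmaFinite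
  obtain ⟨φ, a1, a2, a3⟩ := hX.exists_approx h
  obtain ⟨ψ, b1, b2, b3⟩ := hY.exists_approx h
  have l1 := tendsto_integral_mul_star (𝕜 := ℝ) (fun n => hF.memLp (φ n) i)
    (fun n => hF.memLp (ψ n) j) hX.1 hY.1 a3 b3
  simp only [RCLike.conj_to_real] at l1
  have l2 := tendsto_integral_mul_star a1 b1 (h.memLp_waveFourier t x) (h.memLp_waveFourier s y)
    a2 b2
  have l2' := (Complex.continuous_re.tendsto _).comp l2
  have hcov : ∀ n, ∫ ω, F (φ n) ω i * F (ψ n) ω j ∂P = if i = j then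
      (∫ p, spaceFourier (φ n) p.1 p.2 * starRingEnd ℂ (spaceFourier (ψ n) p.1 p.2)
        ∂(noiseMeasure μ)).re else 0 := by
    intro n
    have h1 := hF.covariance (φ n) (ψ n) i j
    have h2 := congrArg Complex.re h1
    rw [Complex.ofReal_re] at h2
    rw [h2]
    split_ifs with hij
    · have hint : Integrable (fun p : ℝ × E k => spaceFourier (φ n) p.1 p.2 *
          starRingEnd ℂ (spaceFourier (ψ n) p.1 p.2))
          ((volume.restrict (Ioi (0 : ℝ))).prod μ) :=
        MemLp.integrable_mul (a1 n) (b1 n).star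
      rw [noiseMeasure, integral_prod _ hint]
    · simp
  refine tendsto_nhds_unique l1 ?_
  simp only [hcov]
  split_ifs with hij
  · exact l2'
  · exact tendsto_const_nhds

theorem IsNoise.hasGaussianLaw_sum (hF : IsNoise μ P F) {ι : Type*} [Fintype ι] (c : ι → ℝ)
    (φ : ι → Test k) (j : ι → Fin d) :
    HasGaussianLaw (fun ω => ∑ i, c i * F (φ i) ω (j i)) P := by
  have h1 := (hF.gaussian.comp_right φ).comp_left fun i => c i • EuclideanSpace.proj (𝕜 := ℝ) (j i)
  exact h1.hasGaussianLaw_fun_sum (I := Finset.univ)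

theorem integral_exp_of_centered [IsProbabilityMeasure P] {Y : Ω → ℝ}
    (hY : HasGaussianLaw Y P) (h0 : ∫ ω, Y ω ∂P = 0) :
    ∫ ω, Complex.exp ((Y ω : ℂ) * Complex.I) ∂P =
      Complex.exp (-((∫ ω, Y ω * Y ω ∂P : ℝ) : ℂ) / 2) := by
  have h1 : charFun (P.map Y) 1 = ∫ ω, Complex.exp ((Y ω : ℂ) * Complex.I) ∂P := by
    rw [charFun_apply_real, integral_map hY.aemeasurable (by fun_prop)]
    simp
  have h2 : Var[Y; P] = ∫ ω, Y ω * Y ω ∂P := by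
    rw [variance_of_integral_eq_zero hY.aemeasurable h0]
    simp [sq]
  rw [← h1, hY.map_eq_gaussianReal, charFun_gaussianReal, h0,
    Real.coe_toNNReal _ (variance_nonneg _ _), h2]
  congr 1
  simp
  ring

/-- For the approximants the sum is a centered real Gaussian, with characteristic function fixed by
its second moment. Both converge. -/
theorem IsNoise.integral_exp_sum [IsProbabilityMeasure P] (h : HypBeta β μ) (hF : IsNoise μ P F)
    {ι : Type*} [Fintype ι] (c : ι → ℝ) {t : ι → ℝ} {x : ι → E k} {j : ι → Fin d}
    {X : ι → Ω → ℝ}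
    (hX : ∀ i, IsStochIntegral μ P (fun φ ω => F φ ω (j i)) (waveIntegrand (t i) (x i)) (X i)) :
    ∫ ω, Complex.exp (((∑ i, c i * X i ω : ℝ) : ℂ) * Complex.I) ∂P =
      Complex.exp (-((∑ i, ∑ i', c i * c i' * ∫ ω, X i ω * X i' ω ∂P : ℝ) : ℂ) / 2) := by
  choose φ a1 a2 a3 using fun i => (hX i).exists_approx h
  have hm : ∀ n i, MemLp (fun ω => F (φ i n) ω (j i)) 2 P := fun n i => hF.memLp _ _
  have hsm : ∀ n, MemLp (fun ω => ∑ i, c i * F (φ i n) ω (j i)) 2 P := fun n =>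
    memLp_finsetSum _ fun i _ => (hm n i).const_mul (c i)
  have hsX : MemLp (fun ω => ∑ i, c i * X i ω) 2 P :=
    memLp_finsetSum _ fun i _ => (hX i).1.const_mul (c i)
  have l0 := tendsto_eLpNorm_sum c hm (fun i => (hX i).1) a3
  have l1 := tendsto_integral_exp hsm hsX l0
  have l2 := tendsto_integral_mul_star (𝕜 := ℝ) hsm hsm hsX hsX l0 l0
  simp only [RCLike.conj_to_real] at l2
  have hz : ∀ n, ∫ ω, ∑ i, c i * F (φ i n) ω (j i) ∂P = 0 := by
    intro n
    rw [integral_finsetSum _ fun i _ => ((hm n i).integrable (by norm_num)).const_mul (c i)]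
    simp [integral_const_mul, hF.centered]
  have e1 : ∀ n, ∫ ω, Complex.exp (((∑ i, c i * F (φ i n) ω (j i) : ℝ) : ℂ) * Complex.I) ∂P =
      Complex.exp (-((∫ ω, (∑ i, c i * F (φ i n) ω (j i)) *
        (∑ i, c i * F (φ i n) ω (j i)) ∂P : ℝ) : ℂ) / 2) := fun n =>
    integral_exp_of_centered (hF.hasGaussianLaw_sum c (fun i => φ i n) j) (hz n)
  have l3 : Tendsto (fun n => Complex.exp (-((∫ ω, (∑ i, c i * F (φ i n) ω (j i)) *
        (∑ i, c i * F (φ i n) ω (j i)) ∂P : ℝ) : ℂ) / 2)) atTop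
      (𝓝 (Complex.exp (-((∫ ω, (∑ i, c i * X i ω) * (∑ i, c i * X i ω) ∂P : ℝ) : ℂ) / 2))) :=
    ((by fun_prop : Continuous fun v : ℝ => Complex.exp (-(v : ℂ) / 2)).tendsto _).comp l2
  have e2 := tendsto_nhds_unique (l1.congr e1) l3
  rw [e2]
  congr 4
  have hint : ∀ i i', Integrable (fun ω => c i * c i' * (X i ω * X i' ω)) P := fun i i' =>
    (MemLp.integrable_mul (hX i).1 (hX i').1).const_mul _
  have e3 : ∀ ω, (∑ i, c i * X i ω) * (∑ i, c i * X i ω) =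
      ∑ i, ∑ i', c i * c i' * (X i ω * X i' ω) := by
    intro ω
    rw [Finset.sum_mul_sum]
    exact Finset.sum_congr rfl fun i _ => Finset.sum_congr rfl fun i' _ => by ring
  simp only [e3]
  rw [integral_finsetSum _ fun i _ => integrable_finsetSum _ fun i' _ => hint i i']
  refine Finset.sum_congr rfl fun i _ => ?_
  rw [integral_finsetSum _ fun i' _ => hint i i']
  refine Finset.sum_congr rfl fun i' _ => ?_
  rw [integral_const_mul]

theorem waveCov_comm (h : HypBeta β μ) (t : ℝ) (x : E k) (s : ℝ) (y : E k) :
    waveCov μ s y t x = waveCov μ t x s y := by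
  unfold waveCov
  rw [integral_mul_star_eq_inner (h.memLp_waveFourier s y) (h.memLp_waveFourier t x),
    integral_mul_star_eq_inner (h.memLp_waveFourier t x) (h.memLp_waveFourier s y)]
  exact inner_re_symm (𝕜 := ℂ) _ _

theorem IsNoise.integral_exp_pair [IsProbabilityMeasure P] (h : HypBeta β μ) (hF : IsNoise μ P F)
    {t s : ℝ} {x y : E k} {X Y : Fin d → Ω → ℝ}
    (hX : ∀ j, IsStochIntegral μ P (fun φ ω => F φ ω j) (waveIntegrand t x) (X j))
    (hY : ∀ j, IsStochIntegral μ P (fun φ ω => F φ ω j) (waveIntegrand s y) (Y j))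
    (a b : Fin d → ℝ) :
    ∫ ω, Complex.exp (((∑ j, a j * X j ω + ∑ j, b j * Y j ω : ℝ) : ℂ) * Complex.I) ∂P =
      Complex.exp (-((waveCov μ t x t x * ∑ j, a j ^ 2 + waveCov μ s y s y * ∑ j, b j ^ 2 +
        2 * waveCov μ t x s y * ∑ j, a j * b j : ℝ) : ℂ) / 2) := by
  have h1 := hF.integral_exp_sum h (ι := Fin d ⊕ Fin d) (Sum.elim a b)
    (t := Sum.elim (fun _ => t) fun _ => s) (x := Sum.elim (fun _ => x) fun _ => y)
    (j := Sum.elim id id) (X := Sum.elim X Y) (by rintro (j | j); exacts [hX j, hY j])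
  simp only [Fintype.sum_sum_type, Sum.elim_inl, Sum.elim_inr, hF.integral_mul_eq h (hX _) (hX _),
    hF.integral_mul_eq h (hX _) (hY _), hF.integral_mul_eq h (hY _) (hX _),
    hF.integral_mul_eq h (hY _) (hY _)] at h1
  rw [h1]
  congr 4
  simp only [waveCov_comm h t x s y, mul_ite, mul_zero, Finset.sum_ite_eq, Finset.mem_univ, if_true,
    Finset.mul_sum, ← Finset.sum_add_distrib]
  refine Finset.sum_congr rfl fun j _ => ?_
  ring

end StochWave

namespace StochWave

/-! ### Gaussian densities -/

section Density

variable {d : ℕ}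

/-- The density of the centered Gaussian law on `ℝᵈ` with covariance `v • 1`. -/
noncomputable def gaussDensity (v : ℝ) (z : E d) : ℝ :=
  (2 * Real.pi * v) ^ (-((d : ℝ) / 2)) * Real.exp (-(1 / (2 * v)) * ‖z‖ ^ 2)

theorem continuous_gaussDensity (v : ℝ) : Continuous (gaussDensity v : E d → ℝ) := by
  unfold gaussDensity
  fun_prop

theorem gaussDensity_nonneg {v : ℝ} (hv : 0 < v) (z : E d) : 0 ≤ gaussDensity v z := by
  unfold gaussDensity
  positivity

/-- The centered Gaussian law on `ℝᵈ` with covariance `v • 1`. -/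
noncomputable def gaussLaw (d : ℕ) (v : ℝ) : Measure (E d) :=
  volume.withDensity fun z => ENNReal.ofReal (gaussDensity v z)

theorem isFiniteMeasure_gaussLaw {v : ℝ} (hv : 0 < v) : IsFiniteMeasure (gaussLaw d v) := by
  have h1 : Integrable fun z : E d => Real.exp (-(1 / (2 * v)) * ‖z‖ ^ 2) := by
    have hb : 0 < ((1 / (2 * v) : ℝ) : ℂ).re := by
      rw [Complex.ofReal_re]
      positivity
    have h2 := (GaussianFourier.integrable_cexp_neg_mul_sq_norm_add hb 0 (0 : E d)).re
    refine h2.congr (Eventually.of_forall fun z => ?_)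
    have : -((1 / (2 * v) : ℝ) : ℂ) * (‖z‖ : ℂ) ^ 2 + 0 * ((inner ℝ (0 : E d) z : ℝ) : ℂ) =
        ((-(1 / (2 * v)) * ‖z‖ ^ 2 : ℝ) : ℂ) := by
      push_cast
      ring
    simp only [this, ← Complex.ofReal_exp]
    rfl
  exact isFiniteMeasure_withDensity_ofReal (h1.const_mul _).2

theorem charFun_gaussLaw {v : ℝ} (hv : 0 < v) (a : E d) :
    charFun (gaussLaw d v) a = Complex.exp (-((v * ‖a‖ ^ 2 : ℝ) : ℂ) / 2) := by
  have hb : 0 < ((1 / (2 * v) : ℝ) : ℂ).re := by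
    rw [Complex.ofReal_re]
    positivity
  rw [charFun_apply, gaussLaw, integral_withDensity_eq_integral_toReal_smul
    (continuous_gaussDensity v).measurable.ennreal_ofReal
    (Eventually.of_forall fun _ => ENNReal.ofReal_lt_top)]
  have e : ∀ z : E d, (ENNReal.ofReal (gaussDensity v z)).toReal •
      Complex.exp (((inner ℝ z a : ℝ) : ℂ) * Complex.I) =
      (((2 * Real.pi * v) ^ (-((d : ℝ) / 2)) : ℝ) : ℂ) *
        Complex.exp (-((1 / (2 * v) : ℝ) : ℂ) * (‖z‖ : ℂ) ^ 2 +
          Complex.I * ((inner ℝ a z : ℝ) : ℂ)) := by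
    intro z
    rw [ENNReal.toReal_ofReal (gaussDensity_nonneg hv z), gaussDensity, Complex.exp_add,
      real_inner_comm, Complex.real_smul]
    push_cast
    ring_nf
  simp only [e]
  rw [integral_const_mul, GaussianFourier.integral_cexp_neg_mul_sq_norm_add hb,
    finrank_euclideanSpace_fin]
  have h1 : ((Real.pi : ℂ) / ((1 / (2 * v) : ℝ) : ℂ)) ^ ((d : ℂ) / 2) =
      (((2 * Real.pi * v) ^ ((d : ℝ) / 2) : ℝ) : ℂ) := by
    rw [Complex.ofReal_cpow (by positivity)]
    congr 1
    · push_cast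
      field_simp
    · push_cast
      ring
  rw [h1, ← mul_assoc, ← Complex.ofReal_mul, ← Real.rpow_add (by positivity), neg_add_cancel,
    Real.rpow_zero, Complex.ofReal_one, one_mul, Complex.I_sq]
  congr 1
  have : (v : ℂ) ≠ 0 := by exact_mod_cast hv.ne'
  push_cast
  field_simp
  ring

theorem map_withDensity_equiv {α γ : Type*} [MeasurableSpace α] [MeasurableSpace γ]
    (ν : Measure α) (e : α ≃ᵐ γ) (f : α → ℝ≥0∞) :
    (ν.withDensity f).map e = (ν.map e).withDensity (f ∘ e.symm) := by
  ext s hs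
  rw [e.map_apply, withDensity_apply _ hs, withDensity_apply _ (e.measurable hs),
    e.restrict_map, lintegral_map_equiv]
  simp

/-- The volume distortion of the inverse of a linear automorphism. -/
noncomputable def jacobianInv (S : E d ≃L[ℝ] E d) : ℝ :=
  |(LinearMap.det (S.toLinearEquiv : E d →ₗ[ℝ] E d))⁻¹|

theorem jacobianInv_pos (S : E d ≃L[ℝ] E d) : 0 < jacobianInv S :=
  abs_pos.2 (inv_ne_zero (LinearEquiv.isUnit_det' S.toLinearEquiv).ne_zero)

theorem map_withDensity_linear (S : E d ≃L[ℝ] E d) (p : E d → ℝ) :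
    (volume.withDensity fun z => ENNReal.ofReal (p z)).map S =
      volume.withDensity fun z => ENNReal.ofReal (jacobianInv S * p (S.symm z)) := by
  have h1 := map_withDensity_equiv volume S.toHomeomorph.toMeasurableEquiv
    fun z => ENNReal.ofReal (p z)
  have h2 : (volume : Measure (E d)).map S = ENNReal.ofReal (jacobianInv S) • volume :=
    Measure.map_linearMap_addHaar_eq_smul_addHaar volume
      (LinearEquiv.isUnit_det' S.toLinearEquiv).ne_zero
  have h3 : (volume : Measure (E d)).map S.toHomeomorph.toMeasurableEquiv =
      ENNReal.ofReal (jacobianInv S) • volume := h2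
  rw [h3, withDensity_smul_measure, ← withDensity_smul' _ _ ENNReal.ofReal_ne_top] at h1
  refine Eq.trans h1 ?_
  congr 1
  funext z
  rw [ENNReal.ofReal_mul (jacobianInv_pos S).le]
  rfl

/-- The homeomorphism `(x, y) ↦ (x, y + α x)`. -/
noncomputable def shear (d : ℕ) (α : ℝ) : (E d × E d) ≃ₜ (E d × E d) where
  toFun p := (p.1, p.2 + α • p.1)
  invFun p := (p.1, p.2 - α • p.1)
  left_inv p := by simp
  right_inv p := by simp
  continuous_toFun := by fun_prop
  continuous_invFun := by fun_prop

/-- On each fibre the shear is a translation. -/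
theorem measurePreserving_shear (d : ℕ) (α : ℝ) :
    MeasurePreserving (shear d α) volume volume := by
  rw [Measure.volume_eq_prod]
  exact MeasurePreserving.skew_product (g := fun x y : E d => y + α • x) (MeasurePreserving.id _)
    (by fun_prop) (Eventually.of_forall fun x => map_add_right_eq_self _ _)

theorem map_withDensity_shear (α : ℝ) (p : E d × E d → ℝ) :
    (volume.withDensity fun z => ENNReal.ofReal (p z)).map (shear d α) =
      volume.withDensity fun z => ENNReal.ofReal (p (z.1, z.2 - α • z.1)) := by
  have h1 := map_withDensity_equiv volume (shear d α).toMeasurableEquiv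
    fun z => ENNReal.ofReal (p z)
  have h2 : (volume : Measure (E d × E d)).map (shear d α).toMeasurableEquiv = volume :=
    (measurePreserving_shear d α).map_eq
  rw [h2] at h1
  exact h1

/-- The density of the image under `S` of the Gaussian law with covariance `v • 1`. -/
noncomputable def imageDensity (S : E d ≃L[ℝ] E d) (v : ℝ) (z : E d) : ℝ :=
  jacobianInv S * gaussDensity v (S.symm z)

theorem continuous_imageDensity (S : E d ≃L[ℝ] E d) (v : ℝ) : Continuous (imageDensity S v) :=
  continuous_const.mul ((continuous_gaussDensity v).comp S.symm.continuous)

theorem imageDensity_nonneg (S : E d ≃L[ℝ] E d) {v : ℝ} (hv : 0 < v) (z : E d) :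
    0 ≤ imageDensity S v z :=
  mul_nonneg (jacobianInv_pos S).le (gaussDensity_nonneg hv _)

variable {Ω : Type*} [MeasurableSpace Ω] {P : Measure Ω} [IsProbabilityMeasure P]
  {X Y : Ω → E d}

/-- Finite measures with the same characteristic function agree, so the total mass of `gaussLaw`
never has to be computed. -/
theorem hasContDensity_of_charFun (S : E d ≃L[ℝ] E d) {v : ℝ} (hv : 0 < v)
    (hX : AEMeasurable X P)
    (h : ∀ a : E d, ∫ ω, Complex.exp (((inner ℝ (X ω) a : ℝ) : ℂ) * Complex.I) ∂P =
      Complex.exp (-((v * ‖a‖ ^ 2 : ℝ) : ℂ) / 2)) :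
    HasContDensity (P.map fun ω => S (X ω)) (imageDensity S v) := by
  refine ⟨continuous_imageDensity S v, imageDensity_nonneg S hv, ?_⟩
  have := isFiniteMeasure_gaussLaw (d := d) hv
  have h1 : P.map X = gaussLaw d v := by
    have := Measure.isProbabilityMeasure_map (μ := P) hX
    refine Measure.ext_of_charFun (funext fun a => ?_)
    rw [charFun_gaussLaw hv, ← h a, charFun_apply, integral_map hX (by fun_prop)]
  have h2 : (P.map X).map S = P.map fun ω => S (X ω) :=
    AEMeasurable.map_map_of_aemeasurable S.continuous.measurable.aemeasurable hX
  rw [← h2, h1]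
  exact map_withDensity_linear S _

theorem map_prod_eq_gaussLaw_prod {v w : ℝ} (hv : 0 < v) (hw : 0 < w)
    (hX : AEMeasurable X P) (hY : AEMeasurable Y P)
    (h : ∀ a b : E d,
      ∫ ω, Complex.exp (((inner ℝ (X ω) a + inner ℝ (Y ω) b : ℝ) : ℂ) * Complex.I) ∂P =
        Complex.exp (-((v * ‖a‖ ^ 2 + w * ‖b‖ ^ 2 : ℝ) : ℂ) / 2)) :
    P.map (fun ω => (X ω, Y ω)) = (gaussLaw d v).prod (gaussLaw d w) := by
  have := isFiniteMeasure_gaussLaw (d := d) hv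
  have := isFiniteMeasure_gaussLaw (d := d) hw
  have hXY : AEMeasurable (fun ω => (X ω, Y ω)) P := hX.prodMk hY
  have := Measure.isProbabilityMeasure_map (μ := P) hXY
  refine charFun_eq_prod_iff.1 fun a => ?_
  have hm : AEMeasurable (MeasurableEquiv.toLp 2 (E d × E d) ∘ fun ω => (X ω, Y ω)) P :=
    (MeasurableEquiv.toLp 2 (E d × E d)).measurable.comp_aemeasurable hXY
  rw [← MeasurableEquiv.coe_toLp, AEMeasurable.map_map_of_aemeasurable
    (MeasurableEquiv.toLp 2 (E d × E d)).measurable.aemeasurable hXY, charFun_apply,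
    integral_map hm (by fun_prop), charFun_gaussLaw hv, charFun_gaussLaw hw, ← Complex.exp_add]
  have h1 := h (WithLp.ofLp a).1 (WithLp.ofLp a).2
  refine Eq.trans ?_ (h1.trans ?_)
  · simp [WithLp.prod_inner_apply]
  · congr 1
    push_cast
    ring

/-- The density of `(SX, SY)` when `X` has covariance `v • 1` and `Y - αX` is independent of `X`
with covariance `w • 1`. -/
noncomputable def pairDensity (S : E d ≃L[ℝ] E d) (v w α : ℝ) (z : E d × E d) : ℝ :=
  imageDensity S v z.1 * imageDensity S w (z.2 - α • z.1)

/-- Regression: Y - (r/v₁)X is independent of X. The product law is mapped by `S` on each factor,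
then sheared back; the shear commutes with `S` because its coefficient is scalar. -/
theorem hasContDensity_pair (S : E d ≃L[ℝ] E d) {v₁ v₂ r : ℝ} (hv : 0 < v₁)
    (hw : 0 < v₂ - r ^ 2 / v₁) (hX : AEMeasurable X P) (hY : AEMeasurable Y P)
    (h : ∀ a b : E d,
      ∫ ω, Complex.exp (((inner ℝ (X ω) a + inner ℝ (Y ω) b : ℝ) : ℂ) * Complex.I) ∂P =
        Complex.exp (-((v₁ * ‖a‖ ^ 2 + v₂ * ‖b‖ ^ 2 + 2 * r * inner ℝ a b : ℝ) : ℂ) / 2)) :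
    HasContDensity (P.map fun ω => (S (X ω), S (Y ω)))
      (pairDensity S v₁ (v₂ - r ^ 2 / v₁) (r / v₁)) := by
  set w := v₂ - r ^ 2 / v₁ with hwdef
  set α := r / v₁ with hα
  have hcv := continuous_imageDensity S v₁
  have hcw := continuous_imageDensity S w
  refine ⟨by unfold pairDensity; fun_prop,
    fun z => mul_nonneg (imageDensity_nonneg S hv _) (imageDensity_nonneg S hw _), ?_⟩
  set Z : Ω → E d := fun ω => Y ω - α • X ω with hZ
  have hZm : AEMeasurable Z P := hY.sub (hX.const_smul α)
  have h1 : P.map (fun ω => (X ω, Z ω)) = (gaussLaw d v₁).prod (gaussLaw d w) := by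
    refine map_prod_eq_gaussLaw_prod hv hw hX hZm fun a b => ?_
    have e1 : ∀ ω, inner ℝ (X ω) a + inner ℝ (Z ω) b =
        inner ℝ (X ω) (a - α • b) + inner ℝ (Y ω) b := by
      intro ω
      rw [hZ, inner_sub_left, inner_sub_right, real_inner_smul_left, real_inner_smul_right]
      ring
    simp only [e1]
    rw [h]
    congr 4
    rw [norm_sub_sq_real, inner_sub_left, real_inner_smul_left, real_inner_smul_right, norm_smul,
      mul_pow, real_inner_self_eq_norm_sq, Real.norm_eq_abs, sq_abs, hwdef, hα]
    field_simp
    ring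
  have hS : Measurable S := S.continuous.measurable
  have := isFiniteMeasure_gaussLaw (d := d) hv
  have := isFiniteMeasure_gaussLaw (d := d) hw
  have h2 : (P.map fun ω => (X ω, Z ω)).map (Prod.map S S) =
      volume.withDensity fun z : E d × E d =>
        ENNReal.ofReal (imageDensity S v₁ z.1 * imageDensity S w z.2) := by
    rw [h1, ← Measure.map_prod_map _ _ hS hS, gaussLaw, gaussLaw, map_withDensity_linear,
      map_withDensity_linear]
    change (volume.withDensity fun z => ENNReal.ofReal (imageDensity S v₁ z)).prod
      (volume.withDensity fun z => ENNReal.ofReal (imageDensity S w z)) = _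
    rw [prod_withDensity hcv.measurable.ennreal_ofReal hcw.measurable.ennreal_ofReal,
      Measure.volume_eq_prod]
    congr 1
    funext z
    rw [ENNReal.ofReal_mul (imageDensity_nonneg S hv _)]
  have h3 : ((P.map fun ω => (X ω, Z ω)).map (Prod.map S S)).map (shear d α) =
      P.map fun ω => (S (X ω), S (Y ω)) := by
    rw [AEMeasurable.map_map_of_aemeasurable (hS.prodMap hS).aemeasurable (hX.prodMk hZm),
      AEMeasurable.map_map_of_aemeasurable (shear d α).continuous.measurable.aemeasurable
        ((hS.prodMap hS).comp_aemeasurable (hX.prodMk hZm))]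
    congr 1
    funext ω
    simp [shear, hZ]
  rw [← h3, h2]
  exact map_withDensity_shear α fun z => imageDensity S v₁ z.1 * imageDensity S w z.2

end Density

end StochWave

namespace StochWave

/-! ### Bounds for the covariances -/

section Covariance

variable {k : ℕ} {β : ℝ} {μ : Measure (E k)}

theorem exists_norm_le_of_mem_cube (n : ℕ) (L : ℝ) : ∃ B : ℝ, 0 ≤ B ∧ ∀ z ∈ cube n L, ‖z‖ ≤ B := by
  refine ⟨Real.sqrt (n * L ^ 2), Real.sqrt_nonneg _, fun z hz => ?_⟩
  rw [EuclideanSpace.norm_eq]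
  apply Real.sqrt_le_sqrt
  calc ∑ i, ‖z i‖ ^ 2 ≤ ∑ _i : Fin n, L ^ 2 := Finset.sum_le_sum fun i _ => by
        rw [Real.norm_eq_abs, sq_abs]
        exact sq_le_sq' (hz i).1 (hz i).2
    _ = n * L ^ 2 := by simp

theorem HypBeta.waveCov_increment_le (h : HypBeta β μ) (T : ℝ) :
    ∃ C : ℝ, 0 < C ∧ ∀ t ≤ T, ∀ s ≤ T, ∀ x y : E k,
      waveCov μ t x t x + waveCov μ s y s y - 2 * waveCov μ t x s y ≤
        C * (|t - s| + ‖x - y‖) ^ (2 - β) := by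
  obtain ⟨C, hC, H⟩ := h.lintegral_increment_le T
  refine ⟨C, hC, fun t ht s hs x y => ?_⟩
  have h1 := h.lintegral_comb t x s y 1 (-1)
  have h2 := H t ht s hs x y
  have e : ∀ p : ℝ × E k, ((1 : ℝ) : ℂ) * waveFourier t x p.1 p.2 +
      ((-1 : ℝ) : ℂ) * waveFourier s y p.1 p.2 =
      waveFourier t x p.1 p.2 - waveFourier s y p.1 p.2 := fun p => by
    push_cast
    ring
  simp only [e] at h1
  rw [h1, ENNReal.ofReal_le_ofReal_iff (by positivity)] at h2
  linarith

theorem HypBeta.waveCov_self_le (h : HypBeta β μ) (T : ℝ) :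
    ∃ C : ℝ, 0 < C ∧ ∀ t ∈ Icc 0 T, ∀ x : E k, waveCov μ t x t x ≤ C := by
  have hβ := h.lt_two
  have := h.sigmaFinite
  obtain ⟨C, hC, H⟩ := h.waveCov_increment_le (max T 1)
  refine ⟨C * (max T 1) ^ (2 - β), by positivity, fun t ht x => ?_⟩
  have hT : t ≤ max T 1 := ht.2.trans (le_max_left _ _)
  -- The solution vanishes at time 0, so the increment from (0, x) is the full variance, of order
  -- t^(2-β).
  have h1 := H t hT 0 (by positivity) x x
  have h3 : ∀ᵐ p ∂(noiseMeasure μ), p.1 ∈ Ioi (0 : ℝ) :=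
    Measure.quasiMeasurePreserving_fst.ae (ae_restrict_mem measurableSet_Ioi)
  have h0 : ∀ (s : ℝ) (y : E k), waveCov μ s y 0 x = 0 := by
    intro s y
    rw [waveCov, integral_eq_zero_of_ae, Complex.zero_re]
    filter_upwards [h3] with p hp
    rw [waveFourier_of_le (le_of_lt hp)]
    simp
  rw [h0, h0] at h1
  simp only [sub_zero, sub_self, norm_zero, add_zero, mul_zero, abs_of_nonneg ht.1] at h1
  refine h1.trans ?_
  gcongr
  exact ht.1

theorem HypBeta.le_waveCov_comb (h : HypBeta β μ) {t₀ : ℝ} (ht₀ : 0 < t₀) (R : ℝ) :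
    ∃ c : ℝ, 0 < c ∧ ∀ t s : ℝ, t₀ ≤ t → t₀ ≤ s → |t - s| ≤ R → ∀ x y : E k, ‖x - y‖ ≤ R →
      0 < |t - s| + ‖x - y‖ → ∀ b : ℝ, c * (|t - s| + ‖x - y‖) ^ (2 - β) ≤
        waveCov μ t x t x + b ^ 2 * waveCov μ s y s y + 2 * b * waveCov μ t x s y := by
  obtain ⟨c, hc, H⟩ := h.le_lintegral_comb ht₀ R
  refine ⟨c, hc, fun t s ht hs hR x y hxy hδ b => ?_⟩
  have h1 := H t s ht hs hR x y hxy 1 b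
  rw [h.lintegral_comb, ENNReal.ofReal_le_ofReal_iff'] at h1
  have h2 : 0 < c * 1 ^ 2 * (|t - s| + ‖x - y‖) ^ (2 - β) := by positivity
  rcases h1 with h1 | h1
  · linarith
  · exact absurd h1 (not_le.2 h2)

theorem HypBeta.le_waveCov_self (h : HypBeta β μ) {t₀ : ℝ} (ht₀ : 0 < t₀) :
    ∃ c : ℝ, 0 < c ∧ ∀ t, t₀ ≤ t → ∀ x : E k, c ≤ waveCov μ t x t x := by
  have : NeZero k := ⟨h.pos_dim.ne'⟩
  obtain ⟨c, hc, H⟩ := h.le_waveCov_comb ht₀ 1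
  refine ⟨c, hc, fun t ht x => ?_⟩
  obtain ⟨e, he⟩ := exists_norm_eq (E k) (zero_le_one)
  -- An auxiliary point at unit distance with coefficient b = 0: the bound becomes one on the
  -- variance alone.
  have h1 := H t t ht ht (by simp) x (x - e) (by simp [he]) (by simp [he]) 0
  simpa [he] using h1

/-- The conditional variance is the minimum over `b` of the variance of Y + bX, reached at b =
-r/v₁. The lower bound for combinations is uniform in `b`. -/
theorem HypBeta.le_waveCov_cond (h : HypBeta β μ) {t₀ : ℝ} (ht₀ : 0 < t₀) (R : ℝ) :
    ∃ c : ℝ, 0 < c ∧ ∀ t s : ℝ, t₀ ≤ t → t₀ ≤ s → |t - s| ≤ R → ∀ x y : E k, ‖x - y‖ ≤ R →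
      0 < |t - s| + ‖x - y‖ → c * (|t - s| + ‖x - y‖) ^ (2 - β) ≤
        waveCov μ s y s y - waveCov μ t x s y ^ 2 / waveCov μ t x t x := by
  obtain ⟨c, hc, H⟩ := h.le_waveCov_comb ht₀ R
  obtain ⟨c', hc', H'⟩ := h.le_waveCov_self ht₀
  refine ⟨c, hc, fun t s ht hs hR x y hxy hδ => ?_⟩
  have h1 := H s t hs ht (by rwa [abs_sub_comm]) y x (by rwa [norm_sub_rev])
    (by rwa [abs_sub_comm, norm_sub_rev]) (-(waveCov μ t x s y / waveCov μ t x t x))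
  rw [abs_sub_comm, norm_sub_rev, waveCov_comm h t x s y] at h1
  have hv : 0 < waveCov μ t x t x := hc'.trans_le (H' t ht x)
  refine h1.trans (le_of_eq ?_)
  field_simp
  ring

end Covariance

/-! ### Bounds for the densities -/

section Bounds

variable {d : ℕ}

/-- Cauchy-Schwarz with weights; the defect is an explicit square. Applied with q = 1 - α, it
compares the exponent of the pair with that of the increment, whose variance is w + (1-α)²v. -/
theorem sq_div_add_le {V : Type*} [NormedAddCommGroup V] [InnerProductSpace ℝ V] (A B : V) (q : ℝ)
    {v w : ℝ} (hv : 0 < v) (hw : 0 < w) :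
    ‖A - q • B‖ ^ 2 / (w + q ^ 2 * v) ≤ ‖A‖ ^ 2 / w + ‖B‖ ^ 2 / v := by
  have hpos : 0 < w + q ^ 2 * v := by positivity
  rw [div_le_iff₀ hpos]
  have h1 : ‖A - q • B‖ ≤ ‖A‖ + |q| * ‖B‖ := by
    refine (norm_sub_le _ _).trans ?_
    rw [norm_smul, Real.norm_eq_abs]
  have h2 : (‖A‖ ^ 2 / w + ‖B‖ ^ 2 / v) * (w + q ^ 2 * v) - (‖A‖ + |q| * ‖B‖) ^ 2 =
      (|q| * ‖A‖ * v - ‖B‖ * w) ^ 2 / (v * w) := by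
    rw [← sq_abs q]
    field_simp
    ring
  have h3 : 0 ≤ (|q| * ‖A‖ * v - ‖B‖ * w) ^ 2 / (v * w) := by positivity
  have h4 : ‖A - q • B‖ ^ 2 ≤ (‖A‖ + |q| * ‖B‖) ^ 2 := by gcongr
  linarith

theorem gaussDensity_mul_le (w₁ w₂ : E d) (α : ℝ) {v w : ℝ} (hv : 0 < v) (hw : 0 < w) :
    gaussDensity v w₁ * gaussDensity w (w₂ - α • w₁) ≤
      (2 * Real.pi * v) ^ (-((d : ℝ) / 2)) * (2 * Real.pi * w) ^ (-((d : ℝ) / 2)) *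
        Real.exp (-(‖w₁ - w₂‖ ^ 2 / (2 * (w + (1 - α) ^ 2 * v)))) := by
  have h1 := sq_div_add_le (w₂ - α • w₁) w₁ (1 - α) hv hw
  have e : w₂ - α • w₁ - (1 - α) • w₁ = w₂ - w₁ := by
    module
  rw [e, norm_sub_rev] at h1
  have h2 : gaussDensity v w₁ * gaussDensity w (w₂ - α • w₁) =
      (2 * Real.pi * v) ^ (-((d : ℝ) / 2)) * (2 * Real.pi * w) ^ (-((d : ℝ) / 2)) *
        Real.exp (-(1 / (2 * v)) * ‖w₁‖ ^ 2 + -(1 / (2 * w)) * ‖w₂ - α • w₁‖ ^ 2) := by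
    rw [gaussDensity, gaussDensity, Real.exp_add]
    ring
  rw [h2]
  gcongr
  have h3 : ‖w₁ - w₂‖ ^ 2 / (2 * (w + (1 - α) ^ 2 * v)) =
      1 / 2 * (‖w₁ - w₂‖ ^ 2 / (w + (1 - α) ^ 2 * v)) := by
    have : 0 < w + (1 - α) ^ 2 * v := by positivity
    field_simp
  have h4 : -(1 / (2 * v)) * ‖w₁‖ ^ 2 + -(1 / (2 * w)) * ‖w₂ - α • w₁‖ ^ 2 =
      -(1 / 2 * (‖w₂ - α • w₁‖ ^ 2 / w + ‖w₁‖ ^ 2 / v)) := by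
    field_simp
    ring
  rw [h3, h4]
  linarith

/-- The identity w + (1 - r/v₁)²v₁ = v₁ + v₂ - 2r brings in the increment variance. The factor K² in
the exponent pays for replacing the preimages under `S` by z₁ and z₂. -/
theorem pairDensity_le (S : E d ≃L[ℝ] E d) {cv cw Cγ K v₁ v₂ r δ η : ℝ} (hcv : 0 < cv)
    (hcw : 0 < cw) (hCγ : 0 < Cγ) (hδ : 0 < δ) (hK : 0 < K) (hKS : ∀ z, ‖S z‖ ≤ K * ‖z‖)
    (hv : cv ≤ v₁) (hw : cw * δ ^ η ≤ v₂ - r ^ 2 / v₁) (hγ : v₁ + v₂ - 2 * r ≤ Cγ * δ ^ η)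
    (z₁ z₂ : E d) :
    pairDensity S v₁ (v₂ - r ^ 2 / v₁) (r / v₁) (z₁, z₂) ≤
      jacobianInv S ^ 2 * (2 * Real.pi * cv) ^ (-((d : ℝ) / 2)) *
        (2 * Real.pi * cw) ^ (-((d : ℝ) / 2)) / δ ^ ((d : ℝ) * η / 2) *
        Real.exp (-(1 / (2 * Cγ * K ^ 2) * ‖z₁ - z₂‖ ^ 2 / δ ^ η)) := by
  have hv0 : 0 < v₁ := hcv.trans_le hv
  have hδη : 0 < δ ^ η := by positivity
  have hw0 : 0 < v₂ - r ^ 2 / v₁ := lt_of_lt_of_le (by positivity) hw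
  have hJ := jacobianInv_pos S
  set w := v₂ - r ^ 2 / v₁ with hwdef
  have hγ' : w + (1 - r / v₁) ^ 2 * v₁ = v₁ + v₂ - 2 * r := by
    rw [hwdef]
    field_simp
    ring
  have h1 := gaussDensity_mul_le (S.symm z₁) (S.symm z₂) (r / v₁) hv0 hw0
  have hd : -((d : ℝ) / 2) ≤ 0 := by
    have : (0 : ℝ) ≤ d := Nat.cast_nonneg d
    linarith
  have h2 : (2 * Real.pi * v₁) ^ (-((d : ℝ) / 2)) ≤ (2 * Real.pi * cv) ^ (-((d : ℝ) / 2)) :=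
    Real.rpow_le_rpow_of_nonpos (by positivity) (by gcongr) hd
  have h3 : (2 * Real.pi * w) ^ (-((d : ℝ) / 2)) ≤
      (2 * Real.pi * cw) ^ (-((d : ℝ) / 2)) / δ ^ ((d : ℝ) * η / 2) := by
    have h4 : (2 * Real.pi * w) ^ (-((d : ℝ) / 2)) ≤
        (2 * Real.pi * cw * δ ^ η) ^ (-((d : ℝ) / 2)) :=
      Real.rpow_le_rpow_of_nonpos (by positivity) (by rw [mul_assoc _ cw]; gcongr) hd
    refine h4.trans (le_of_eq ?_)
    rw [Real.mul_rpow (by positivity) hδη.le, ← Real.rpow_mul hδ.le,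
      div_eq_mul_inv _ (δ ^ ((d : ℝ) * η / 2)), ← Real.rpow_neg hδ.le]
    congr 2
    ring
  have hn : ‖z₁ - z₂‖ ≤ K * ‖S.symm z₁ - S.symm z₂‖ := by
    have := hKS (S.symm z₁ - S.symm z₂)
    simpa using this
  have h5 : Real.exp (-(‖S.symm z₁ - S.symm z₂‖ ^ 2 / (2 * (w + (1 - r / v₁) ^ 2 * v₁)))) ≤
      Real.exp (-(1 / (2 * Cγ * K ^ 2) * ‖z₁ - z₂‖ ^ 2 / δ ^ η)) := by
    have hpos : 0 < w + (1 - r / v₁) ^ 2 * v₁ := by positivity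
    apply Real.exp_le_exp.2
    apply neg_le_neg
    calc 1 / (2 * Cγ * K ^ 2) * ‖z₁ - z₂‖ ^ 2 / δ ^ η
        ≤ 1 / (2 * Cγ * K ^ 2) * (K * ‖S.symm z₁ - S.symm z₂‖) ^ 2 / δ ^ η := by gcongr
      _ = ‖S.symm z₁ - S.symm z₂‖ ^ 2 / (2 * (Cγ * δ ^ η)) := by field_simp
      _ ≤ _ := by
        gcongr
        rw [hγ']
        exact hγ
  have e : pairDensity S v₁ w (r / v₁) (z₁, z₂) = jacobianInv S ^ 2 *
      (gaussDensity v₁ (S.symm z₁) * gaussDensity w (S.symm z₂ - (r / v₁) • S.symm z₁)) := by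
    rw [pairDensity, imageDensity, imageDensity, map_sub, map_smul]
    ring
  rw [e]
  calc _ ≤ jacobianInv S ^ 2 * ((2 * Real.pi * v₁) ^ (-((d : ℝ) / 2)) *
        (2 * Real.pi * w) ^ (-((d : ℝ) / 2)) *
        Real.exp (-(‖S.symm z₁ - S.symm z₂‖ ^ 2 / (2 * (w + (1 - r / v₁) ^ 2 * v₁))))) := by
        gcongr
    _ ≤ jacobianInv S ^ 2 * ((2 * Real.pi * cv) ^ (-((d : ℝ) / 2)) *
        ((2 * Real.pi * cw) ^ (-((d : ℝ) / 2)) / δ ^ ((d : ℝ) * η / 2)) *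
        Real.exp (-(1 / (2 * Cγ * K ^ 2) * ‖z₁ - z₂‖ ^ 2 / δ ^ η))) := by
        gcongr
    _ = _ := by ring

theorem imageDensity_le (S : E d ≃L[ℝ] E d) {cv v : ℝ} (hcv : 0 < cv) (hv : cv ≤ v) (z : E d) :
    imageDensity S v z ≤ jacobianInv S * (2 * Real.pi * cv) ^ (-((d : ℝ) / 2)) := by
  have hJ := jacobianInv_pos S
  have hv0 : 0 < v := hcv.trans_le hv
  have hd : -((d : ℝ) / 2) ≤ 0 := by
    have : (0 : ℝ) ≤ d := Nat.cast_nonneg d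
    linarith
  rw [imageDensity, gaussDensity]
  gcongr
  calc _ ≤ (2 * Real.pi * v) ^ (-((d : ℝ) / 2)) * 1 := by
        gcongr
        rw [Real.exp_le_one_iff, neg_mul, neg_nonpos]
        positivity
    _ ≤ _ := by
        rw [mul_one]
        exact Real.rpow_le_rpow_of_nonpos (by positivity) (by gcongr) hd

theorem le_imageDensity (S : E d ≃L[ℝ] E d) {cv Cv v B : ℝ} (hcv : 0 < cv) (hv : cv ≤ v)
    (hv' : v ≤ Cv) {z : E d} (hz : ‖S.symm z‖ ≤ B) :
    jacobianInv S * ((2 * Real.pi * Cv) ^ (-((d : ℝ) / 2)) *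
      Real.exp (-(1 / (2 * cv)) * B ^ 2)) ≤ imageDensity S v z := by
  have hJ := jacobianInv_pos S
  have hv0 : 0 < v := hcv.trans_le hv
  have hCv : 0 < Cv := hv0.trans_le hv'
  have hd : -((d : ℝ) / 2) ≤ 0 := by
    have : (0 : ℝ) ≤ d := Nat.cast_nonneg d
    linarith
  rw [imageDensity, gaussDensity]
  have h1 : (2 * Real.pi * Cv) ^ (-((d : ℝ) / 2)) ≤ (2 * Real.pi * v) ^ (-((d : ℝ) / 2)) :=
    Real.rpow_le_rpow_of_nonpos (by positivity) (by gcongr) hd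
  have h2 : Real.exp (-(1 / (2 * cv)) * B ^ 2) ≤ Real.exp (-(1 / (2 * v)) * ‖S.symm z‖ ^ 2) := by
    apply Real.exp_le_exp.2
    rw [neg_mul, neg_mul, neg_le_neg_iff]
    gcongr
  gcongr

/-- The linear automorphism of `ℝᵈ` given by an invertible matrix. -/
noncomputable def matrixEquiv (σ : Matrix (Fin d) (Fin d) ℝ) (hσ : IsUnit σ.det) :
    E d ≃L[ℝ] E d :=
  ContinuousLinearEquiv.equivOfInverse (Matrix.toEuclideanCLM (𝕜 := ℝ) σ)
    (Matrix.toEuclideanCLM (𝕜 := ℝ) σ⁻¹)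
    (fun z => by
      rw [← mul_apply_eq_comp, ← map_mul, Matrix.nonsing_inv_mul _ hσ, map_one]
      rfl)
    (fun z => by
      rw [← mul_apply_eq_comp, ← map_mul, Matrix.mul_nonsing_inv _ hσ, map_one]
      rfl)

theorem matrixEquiv_apply (σ : Matrix (Fin d) (Fin d) ℝ) (hσ : IsUnit σ.det) (z : E d) (i : Fin d) :
    matrixEquiv σ hσ z i = ∑ j, σ i j * z j := rfl

end Bounds

/-! ### The solution -/

section Solution

variable {k d : ℕ} {β : ℝ} {μ : Measure (E k)} {Ω : Type*} [MeasurableSpace Ω] {P : Measure Ω}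
  {F : Test k → Ω → E d} {σ : Matrix (Fin d) (Fin d) ℝ} {T : ℝ} {u : ℝ → E k → Ω → E d}

/-- Pulling σ out leaves a vector whose covariance is a multiple of the identity. -/
theorem IsSolution.exists_vector (hu : IsSolution μ P F σ T u) (hσ : IsUnit σ.det) {t : ℝ}
    (ht : t ∈ Icc 0 T) (x : E k) :
    ∃ X : Ω → E d, AEMeasurable X P ∧ u t x =ᵐ[P] (fun ω => matrixEquiv σ hσ (X ω)) ∧
      ∀ j, IsStochIntegral μ P (fun φ ω => F φ ω j) (waveIntegrand t x) (fun ω => X ω j) := by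
  obtain ⟨I, hI, hui⟩ := hu t ht x
  refine ⟨fun ω => WithLp.toLp 2 fun j => I j ω, ?_, ?_, hI⟩
  · exact (MeasurableEquiv.toLp 2 (Fin d → ℝ)).measurable.comp_aemeasurable
      (aemeasurable_pi_lambda _ fun j => (hI j).1.1.aemeasurable)
  · filter_upwards [ae_all_iff.2 hui] with ω hω
    ext i
    rw [matrixEquiv_apply]
    exact hω i

theorem IsNoise.integral_exp_inner_pair [IsProbabilityMeasure P] (h : HypBeta β μ)
    (hF : IsNoise μ P F) {t s : ℝ} {x y : E k} {X Y : Ω → E d}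
    (hX : ∀ j, IsStochIntegral μ P (fun φ ω => F φ ω j) (waveIntegrand t x) fun ω => X ω j)
    (hY : ∀ j, IsStochIntegral μ P (fun φ ω => F φ ω j) (waveIntegrand s y) fun ω => Y ω j)
    (a b : E d) :
    ∫ ω, Complex.exp (((inner ℝ (X ω) a + inner ℝ (Y ω) b : ℝ) : ℂ) * Complex.I) ∂P =
      Complex.exp (-((waveCov μ t x t x * ‖a‖ ^ 2 + waveCov μ s y s y * ‖b‖ ^ 2 +
        2 * waveCov μ t x s y * inner ℝ a b : ℝ) : ℂ) / 2) := by
  have h1 := hF.integral_exp_pair h hX hY a b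
  have hi : ∀ z w : E d, inner ℝ z w = ∑ j, w j * z j := fun z w => by
    simp [PiLp.inner_apply]
  have hn : ∀ z : E d, ‖z‖ ^ 2 = ∑ j, z j ^ 2 := fun z => by
    simp [EuclideanSpace.norm_sq_eq]
  simp only [hi, hn]
  rw [h1]
  simp only [mul_comm (a _) (b _)]

end Solution

end StochWave

/-! ### Choice of the constants and conclusion -/

theorem mainTheorem10 (k d : ℕ) (β : ℝ) (μ : Measure (E k)) (hμ : HypBeta β μ)
    (σ : Matrix (Fin d) (Fin d) ℝ) (hσ : IsUnit σ.det) (t₀ T M N : ℝ)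
    (ht₀ : 0 < t₀) (hM : 0 < M) (hN : 0 < N) :
    ∃ C c C₁ C₂ : ℝ, 0 < C ∧ 0 < c ∧ 0 < C₁ ∧ 0 < C₂ ∧
      ∀ (Ω : Type*) [MeasurableSpace Ω] (P : Measure Ω) [IsProbabilityMeasure P]
        (F : Test k → Ω → E d) (u : ℝ → E k → Ω → E d),
        IsNoise μ P F → IsSolution μ P F σ T u →
        (∀ t ∈ Icc t₀ T, ∀ s ∈ Icc t₀ T, ∀ x ∈ cube k M, ∀ y ∈ cube k M, (t, x) ≠ (s, y) →
          ∃ p : E d × E d → ℝ, HasContDensity (P.map fun ω => (u t x ω, u s y ω)) p ∧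
            ∀ z₁ ∈ cube d N, ∀ z₂ ∈ cube d N,
              p (z₁, z₂) ≤ C / (|t - s| + ‖x - y‖) ^ ((d : ℝ) * (2 - β) / 2) *
                Real.exp (-(c * ‖z₁ - z₂‖ ^ 2 / (|t - s| + ‖x - y‖) ^ (2 - β)))) ∧
        (∀ t ∈ Icc t₀ T, ∀ x : E k,
          ∃ p : E d → ℝ, HasContDensity (P.map (u t x)) p ∧
            ∀ z ∈ cube d N, C₁ ≤ p z ∧ p z ≤ C₂) := by
  set S := matrixEquiv σ hσ
  obtain ⟨Bk, hBk, hcube⟩ := exists_norm_le_of_mem_cube k M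
  obtain ⟨B, hB, hcube'⟩ := exists_norm_le_of_mem_cube d N
  obtain ⟨Cγ, hCγ, Hγ⟩ := hμ.waveCov_increment_le T
  obtain ⟨Cv, hCv, HCv⟩ := hμ.waveCov_self_le T
  obtain ⟨cv, hcv, Hcv⟩ := hμ.le_waveCov_self ht₀
  -- Both separations stay below this radius: |t-s| ≤ T since the times lie in [t₀, T], and ‖x-y‖ is
  -- at most twice the norm bound on the cube.
  obtain ⟨cw, hcw, Hcw⟩ := hμ.le_waveCov_cond ht₀ (max T (Bk + Bk))
  set K : ℝ := ‖(S : E d →L[ℝ] E d)‖ + 1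
  set B' : ℝ := ‖(S.symm : E d →L[ℝ] E d)‖ * B
  have hK : 0 < K := by positivity
  have hKS : ∀ z, ‖S z‖ ≤ K * ‖z‖ := fun z => by
    refine ((S : E d →L[ℝ] E d).le_opNorm z).trans ?_
    gcongr
    exact le_add_of_nonneg_right zero_le_one
  have hJ := jacobianInv_pos S
  refine ⟨jacobianInv S ^ 2 * (2 * Real.pi * cv) ^ (-((d : ℝ) / 2)) *
      (2 * Real.pi * cw) ^ (-((d : ℝ) / 2)), 1 / (2 * Cγ * K ^ 2),
    jacobianInv S * ((2 * Real.pi * Cv) ^ (-((d : ℝ) / 2)) *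
      Real.exp (-(1 / (2 * cv)) * B' ^ 2)),
    jacobianInv S * (2 * Real.pi * cv) ^ (-((d : ℝ) / 2)), by positivity, by positivity,
    by positivity, by positivity, ?_⟩
  intro Ω _ P _ F u hF hu
  constructor
  · intro t ht s hs x hx y hy hne
    obtain ⟨X, hXm, hXu, hX⟩ := hu.exists_vector hσ (Icc_subset_Icc_left ht₀.le ht) x
    obtain ⟨Y, hYm, hYu, hY⟩ := hu.exists_vector hσ (Icc_subset_Icc_left ht₀.le hs) y
    have hδ : 0 < |t - s| + ‖x - y‖ := by
      refine lt_of_le_of_ne (by positivity) fun h0 => hne ?_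
      have h1 := (add_eq_zero_iff_of_nonneg (abs_nonneg (t - s)) (norm_nonneg (x - y))).1 h0.symm
      rw [sub_eq_zero.1 (abs_eq_zero.1 h1.1), sub_eq_zero.1 (norm_eq_zero.1 h1.2)]
    have hv : cv ≤ waveCov μ t x t x := Hcv t ht.1 x
    have hv0 := hcv.trans_le hv
    have hts : |t - s| ≤ max T (Bk + Bk) := by
      refine le_trans ?_ (le_max_left _ _)
      rw [abs_le]
      constructor <;> linarith [ht.1, ht.2, hs.1, hs.2]
    have hxy : ‖x - y‖ ≤ max T (Bk + Bk) :=
      ((norm_sub_le _ _).trans (add_le_add (hcube x hx) (hcube y hy))).trans (le_max_right _ _)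
    have hw := Hcw t s ht.1 hs.1 hts x y hxy hδ
    have hw0 : 0 < waveCov μ s y s y - waveCov μ t x s y ^ 2 / waveCov μ t x t x :=
      lt_of_lt_of_le (by positivity) hw
    have hmap : P.map (fun ω => (u t x ω, u s y ω)) = P.map fun ω => (S (X ω), S (Y ω)) :=
      Measure.map_congr (hXu.prodMk hYu)
    rw [hmap]
    refine ⟨_, hasContDensity_pair S hv0 hw0 hXm hYm (hF.integral_exp_inner_pair hμ hX hY),
      fun z₁ _ z₂ _ => ?_⟩
    exact pairDensity_le S hcv hcw hCγ hδ hK hKS hv hw (Hγ t ht.2 s hs.2 x y) z₁ z₂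
  · intro t ht x
    have ht' := Icc_subset_Icc_left ht₀.le ht
    obtain ⟨X, hXm, hXu, hX⟩ := hu.exists_vector hσ ht' x
    have hv : cv ≤ waveCov μ t x t x := Hcv t ht.1 x
    rw [Measure.map_congr hXu]
    refine ⟨_, hasContDensity_of_charFun S (hcv.trans_le hv) hXm fun a => ?_, fun z hz =>
      ⟨le_imageDensity S hcv hv (HCv t ht' x) ?_, imageDensity_le S hcv hv z⟩⟩
    -- The one-point law is the pair formula with the second frequency equal to zero.
    · simpa using hF.integral_exp_inner_pair hμ hX hX a 0
    · exact ((S.symm : E d →L[ℝ] E d).le_opNorm z).trans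
        (mul_le_mul_of_nonneg_left (hcube' z hz) (norm_nonneg _))
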